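/- Graphs are finite and simple, and $|G|$ is the number of vertices of $G$. For $A,B\subseteq V(G)$, $A$ covers $B$ if every vertex of $B$ has a neighbour in $A$, and $A,B$ are anticomplete if there is no edge between them. A blockade in $G$ is a family $\mathcal A=(A_i:i\in I)$ of nonempty, pairwise disjoint subsets (blocks) of $V(G)$ indexed by a finite set $I$ of integers; its length is $|I|$. Its linkage is the maximum, over all distinct $i,j\in I$ and all $v\in A_i$, of (the number of neighbours of $v$ in $A_j$)$/|A_j|$ (zero if $|I|\le 1$). It is $(\gamma,\delta)$-divergent if there are distinct $i,j\in I$ and anticomplete sets $X\subseteq A_i$, $Y\subseteq A_j$ with $|X|\ge\gamma|A_i|$ and $|Y|\ge\delta|A_j|$. A levelling in $G$ of height $h\ge 1$ is a sequence $\mathcal L=(L_0,\ldots,L_h)$ of pairwise disjoint subsets of $V(G)$ such that $|L_0|=1$, $L_{i-1}$ covers $L_i$ for $1\le i\le h$, and $L_0\cup\cdots\cup L_{i-2}$ is anticomplete to $L_i$ for $2\le i\le h$. It reaches $C\subseteq V(G)$ if $(L_0,\ldots,L_h,C)$ is a levelling. It grades a blockade $\mathcal C=(C_j:j\in J)$ forwards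 if it reaches $\bigcup_{j\in J}C_j$ and for each $j\in J$ there is $Y\subseteq L_h$ that covers $\bigcup_{i\in J,\,i\ge j}C_i$ and is anticomplete to $\bigcup_{i\in J,\,i<j}C_i$. A bi-levelling in $G$ is a triple $(\mathcal L,\mathcal M,\mathcal C)$, where $\mathcal L=(L_0,\ldots,L_h)$ and $\mathcal M=(M_0,\ldots,M_m)$ are levellings and $\mathcal C=(C_j:j\in J)$ is a blockade in $G$, such that $L_0=M_0$; $M_1\cup\cdots\cup M_m$ is disjoint from and anticomplete to $L_1\cup\cdots\cup L_h$; $\mathcal L$ and $\mathcal M$ both reach $\bigcup_{j\in J}C_j$; and $\mathcal L$ grades $\mathcal C$ forwards. Its length is $|J|$ and its height is $h+m$. It is $\mathcal A$-rainbow if each of the sets $C_j\;(j\in J)$, $L_i\;(0\le i\le h)$, $M_i\;(1\le i\le m)$ is a subset of some block of $\mathcal A$, and each block of $\mathcal A$ includes at most one of these sets. In that case the $\mathcal A$-size of $\mathcal C$ is the minimum over $j\in J$ of $|C_j|/|A_i|$, where $A_i$ is the block of $\mathcal A$ that includes $C_j$. **Theorem.** Let $k\ge 1$ be an integer, and let $c>0$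 be real. Let $\rho=\lceil 1+1/c\rceil$, let $\ell\ge 3\rho-2$ be an integer, and let $K=\lceil k(3+1/c)^{\ell+2}\rceil$. Let $\gamma,\lambda>0$ with $\lambda,\gamma\le 2^{-8-\ell}/(\rho^3K)$. Let $G$ be a graph and let $\delta=K^{-K}|G|^{-c}$. Let $\mathcal A$ be a blockade in $G$ of length $K$, with linkage at most $\lambda$, that is not $(\gamma,\delta)$-divergent. Then there is an $\mathcal A$-rainbow bi-levelling $(\mathcal L,\mathcal M,\mathcal C)$ in $G$ with length $k$ and height $\ell$, such that $\mathcal C$ has $\mathcal A$-size at least $2^{4-\ell}/(\rho^3K)$. -/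

import Mathlib

open scoped NNReal

/-- Every vertex of `B` has a neighbour in `A`. -/
def Covers {V : Type*} (G : SimpleGraph V) (A B : Finset V) : Prop :=
  ∀ b ∈ B, ∃ a ∈ A, G.Adj a b

/-- No vertex of `A` has a neighbour in `B`. -/
def Anticomplete {V : Type*} (G : SimpleGraph V) (A B : Finset V) : Prop :=
  ∀ a ∈ A, ∀ b ∈ B, ¬ G.Adj a b

open Classical in
/-- The max-degree from `A` to `B`: the maximum over `v ∈ A` of the number of neighbours
of `v` in `B`. -/
noncomputable def maxDegreeTo {V : Type*} (G : SimpleGraph V) (A B : Finset V) : ℕ :=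
  A.sup fun v => (B.filter fun w => G.Adj v w).card

/-- A blockade: a family of nonempty, pairwise disjoint vertex sets indexed by a (finite) set of
integers. The values of `block` outside `index` are irrelevant. -/
structure Blockade (V : Type*) where
  index : Finset ℤ
  block : ℤ → Finset V
  nonempty : ∀ i ∈ index, (block i).Nonempty
  disjoint : ∀ i ∈ index, ∀ j ∈ index, i ≠ j → Disjoint (block i) (block j)

namespace Blockade

/-- The number of blocks. -/
def length {V : Type*} (A : Blockade V) : ℕ := A.index.card

open Classical in
/-- The union of all blocks. -/
noncomputable def vertices {V : Type*} (A : Blockade V) : Finset V :=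
  A.index.biUnion A.block

/-- The maximum, over all ordered pairs of distinct indices `i, j`, of the max-degree from block `i`
to block `j` divided by the size of block `j`; it is zero if there are no such pairs. -/
noncomputable def linkage {V : Type*} (G : SimpleGraph V) (A : Blockade V) : ℝ≥0 :=
  A.index.offDiag.sup fun p =>
    (maxDegreeTo G (A.block p.1) (A.block p.2) : ℝ≥0) / ((A.block p.2).card : ℝ≥0)

/-- `(γ, δ)`-divergence: there are `X`, `Y` in distinct blocks, anticomplete to each other, of
proportions at least `γ` and `δ` respectively. -/
def Divergent {V : Type*} (G : SimpleGraph V) (A : Blockade V) (γ δ : ℝ) : Prop :=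
  ∃ i ∈ A.index, ∃ j ∈ A.index, i ≠ j ∧ ∃ X ⊆ A.block i, ∃ Y ⊆ A.block j,
    γ * ((A.block i).card : ℝ) ≤ (X.card : ℝ) ∧ δ * ((A.block j).card : ℝ) ≤ (Y.card : ℝ) ∧
      Anticomplete G X Y

/-- `X` is contained in some block of `A`, and `s` is the proportion of that block occupied by `X`:
the `A`-size of `X` is (defined and equal to) `s`. -/
def HasSize {V : Type*} (A : Blockade V) (X : Finset V) (s : ℝ) : Prop :=
  ∃ i ∈ A.index, X ⊆ A.block i ∧ s = (X.card : ℝ) / ((A.block i).card : ℝ)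

/-- The `A`-size of the blockade `C` (the minimum of the `A`-sizes of its blocks) is defined and at
least `κ`. -/
def SizeAtLeast {V : Type*} (A C : Blockade V) (κ : ℝ) : Prop :=
  ∀ j ∈ C.index, ∃ s, A.HasSize (C.block j) s ∧ κ ≤ s

end Blockade

/-- `(L 0, …, L k)` is a levelling in `G`. The values `L i` for `i > k` are irrelevant. -/
structure IsLevelling {V : Type*} (G : SimpleGraph V) (k : ℕ) (L : ℕ → Finset V) : Prop where
  one_le : 1 ≤ k
  disjoint : ∀ i ≤ k, ∀ j ≤ k, i ≠ j → Disjoint (L i) (L j)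
  card_zero : (L 0).card = 1
  covers : ∀ i < k, Covers G (L i) (L (i + 1))
  anticomplete : ∀ i j, i + 2 ≤ j → j ≤ k → Anticomplete G (L i) (L j)

/-- A levelling `(level 0, …, level height)` in `G`. -/
structure Levelling {V : Type*} (G : SimpleGraph V) where
  height : ℕ
  level : ℕ → Finset V
  isLevelling : IsLevelling G height level

namespace Levelling

/-- `(L 0, …, L k, C)` is again a levelling. -/
def Reaches {V : Type*} {G : SimpleGraph V} (L : Levelling G) (C : Finset V) : Prop :=
  IsLevelling G (L.height + 1) (Function.update L.level (L.height + 1) C)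

/-- Same apex, and the unions of the remaining levels are disjoint and anticomplete. -/
def Parallel {V : Type*} {G : SimpleGraph V} (L M : Levelling G) : Prop :=
  L.level 0 = M.level 0 ∧
    ∀ i, 1 ≤ i → i ≤ M.height → ∀ j, 1 ≤ j → j ≤ L.height →
      Disjoint (M.level i) (L.level j) ∧ Anticomplete G (M.level i) (L.level j)

/-- `L` reaches the union of the blocks of `B`, and for each index `j` some subset of the base of `L`
covers all blocks with index at least `j` and is anticomplete to all blocks with index below `j`. -/
def GradesForwards {V : Type*} {G : SimpleGraph V} (L : Levelling G) (B : Blockade V) : Prop :=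
  L.Reaches B.vertices ∧
    ∀ j ∈ B.index, ∃ Y ⊆ L.level L.height,
      (∀ i ∈ B.index, j ≤ i → Covers G Y (B.block i)) ∧
      (∀ i ∈ B.index, i < j → Anticomplete G Y (B.block i))

end Levelling

/-- A bi-levelling `(L, M, C)` in `G`. -/
structure BiLevelling {V : Type*} (G : SimpleGraph V) where
  L : Levelling G
  M : Levelling G
  C : Blockade V
  parallel : L.Parallel M
  reaches_left : L.Reaches C.vertices
  reaches_right : M.Reaches C.vertices
  grades : L.GradesForwards C

namespace BiLevelling

/-- The number of blocks of a bi-levelling. -/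
def length {V : Type*} {G : SimpleGraph V} (S : BiLevelling G) : ℕ := S.C.length

/-- The sum of the heights of the two levellings. -/
def height {V : Type*} {G : SimpleGraph V} (S : BiLevelling G) : ℕ := S.L.height + S.M.height

/-- Labels for the constituents of a bi-levelling: the blocks of `C`, the levels `0, …, L.height` of
`L`, and the levels `1, …, M.height` of `M`. -/
abbrev Part {V : Type*} {G : SimpleGraph V} (S : BiLevelling G) : Type :=
  S.C.index ⊕ Fin (S.L.height + 1) ⊕ Fin S.M.height

/-- The vertex set carried by a label. -/
def part {V : Type*} {G : SimpleGraph V} (S : BiLevelling G) : S.Part → Finset V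
  | .inl j => S.C.block j
  | .inr (.inl i) => S.L.level i
  | .inr (.inr i) => S.M.level (i + 1)

/-- Each constituent lies in some block of `A`, and each block of `A` includes at most one
constituent. -/
def Rainbow {V : Type*} {G : SimpleGraph V} (S : BiLevelling G) (A : Blockade V) : Prop :=
  (∀ p : S.Part, ∃ i ∈ A.index, S.part p ⊆ A.block i) ∧
    ∀ i ∈ A.index, ∀ p q : S.Part, S.part p ⊆ A.block i → S.part q ⊆ A.block i → p = q

end BiLevelling

/-! ### Neighbourhoods and expansion between blocks -/

section
open scoped Classical

variable {V : Type*} {G : SimpleGraph V}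

/-! Put r = ρ - 1, m = ⌈|G|^c⌉, and let ε be the common bound on γ and λ; then |G| ≤ m^r and δm ≤ ε.
Non-divergence says that a set of proportion δ in one block covers all but a proportion less than ε
of every other block (`Expands`). One device does most of the work: if S covers a proportion ε of a
block, some subset of about |S|/m vertices still covers a proportion δ of it (`exists_shrink`), and
proportion δ expands again. After r shrinkings a single vertex remains. So every set of proportion δ
contains a vertex from which walks through r prescribed blocks reach almost all of each further
block (`Expands.exists_conn`).

Take q that reaches most of the other blocks both through a list D and through a list E of r blocks.
By `Expands.exists_split_targets`, parts of many target blocks are reached from q through those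
vertices of the blocks in D that have no neighbour in large parts S i of r + 1 further blocks. Some
vertex y of one S i is joined to q by a path Q through E, and reaches the targets through the other
r sets S i. For a target vertex w, let the apex be the last vertex of Q with a walk to w through D.
A shortest such walk, and a shortest walk from the apex to w through the rest of Q and the sets S i,
have no edges between their interiors: an edge from a later vertex of Q would contradict the choice
of apex, and the sets S i were made anticomplete to D. Fixing the apex and the types of both walks
by pigeonhole turns them into two levellings (`exists_twoSided_of_path`), of total height at most r
+ (r + 1) + r = 3ρ - 2 ≤ ℓ.

To reach height exactly ℓ, one end is lengthened a level at a time (`TwoSided.exists_succ`). A step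
divides the proportions by r + 2 and the number of targets by about r + 1, so the pigeonhole is
weighted to demand more from shorter types. Finally `Expands.exists_grading` extracts k targets
graded by the other end. -/

/-- The vertices of `S` that have a neighbour in `P`. -/
noncomputable def hit (G : SimpleGraph V) (P S : Finset V) : Finset V :=
  S.filter fun v => ∃ p ∈ P, G.Adj p v

theorem mem_hit {P S : Finset V} {v : V} : v ∈ hit G P S ↔ v ∈ S ∧ ∃ p ∈ P, G.Adj p v := by
  simp [hit]

theorem hit_subset (P S : Finset V) : hit G P S ⊆ S := Finset.filter_subset _ _

theorem hit_union (P Q S : Finset V) : hit G (P ∪ Q) S = hit G P S ∪ hit G Q S := by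
  ext v
  simp only [mem_hit, Finset.mem_union]
  constructor
  · rintro ⟨h1, p, hp | hp, h2⟩
    · exact Or.inl ⟨h1, p, hp, h2⟩
    · exact Or.inr ⟨h1, p, hp, h2⟩
  · rintro (⟨h1, p, hp, h2⟩ | ⟨h1, p, hp, h2⟩)
    · exact ⟨h1, p, Or.inl hp, h2⟩
    · exact ⟨h1, p, Or.inr hp, h2⟩

theorem hit_empty (S : Finset V) : hit G ∅ S = ∅ := by
  ext v; simp [mem_hit]

theorem hit_eq_of_covers {P S : Finset V} (h : Covers G P S) : hit G P S = S :=
  Finset.Subset.antisymm (hit_subset _ _) fun v hv => mem_hit.2 ⟨hv, h v hv⟩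

theorem covers_hit (P S : Finset V) : Covers G P (hit G P S) := fun _ hv => (mem_hit.1 hv).2

theorem anticomplete_sdiff_hit (P S : Finset V) : Anticomplete G P (S \ hit G P S) := by
  intro p hp v hv hadj
  rw [Finset.mem_sdiff] at hv
  exact hv.2 (mem_hit.2 ⟨hv.1, p, hp, hadj⟩)

theorem Anticomplete.mono {A B A' B' : Finset V} (h : Anticomplete G A B) (hA : A' ⊆ A)
    (hB : B' ⊆ B) : Anticomplete G A' B' := fun a ha b hb => h a (hA ha) b (hB hb)

theorem Anticomplete.symm {A B : Finset V} (h : Anticomplete G A B) : Anticomplete G B A :=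
  fun a ha b hb hadj => h b hb a ha hadj.symm

theorem Covers.mono {A B B' : Finset V} (h : Covers G A B) (hB : B' ⊆ B) : Covers G A B' :=
  fun b hb => h b (hB hb)

theorem card_hit_add_card_sdiff (P S : Finset V) :
    ((hit G P S).card : ℝ) + ((S \ hit G P S).card : ℝ) = S.card := by
  have := Finset.card_sdiff_add_card_eq_card (hit_subset (G := G) P S)
  exact_mod_cast (by omega : (hit G P S).card + (S \ hit G P S).card = S.card)

/-- The neighbourhood properties of a blockade that the construction uses: single vertices have
few neighbours in other blocks, and sets of proportion `δ` cover almost all of every other block. -/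
structure Expands (G : SimpleGraph V) (A : Blockade V) (ε δ : ℝ) : Prop where
  degree : ∀ i ∈ A.index, ∀ j ∈ A.index, i ≠ j → ∀ v ∈ A.block i, ∀ W ⊆ A.block j,
    ((hit G {v} W).card : ℝ) ≤ ε * (A.block j).card
  expand : ∀ i ∈ A.index, ∀ j ∈ A.index, i ≠ j → ∀ X ⊆ A.block i,
    δ * (A.block i).card ≤ X.card → ∀ W ⊆ A.block j,
      ((W \ hit G X W).card : ℝ) < ε * (A.block j).card

theorem Blockade.card_block_pos (A : Blockade V) {i : ℤ} (hi : i ∈ A.index) :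
    (0 : ℝ) < (A.block i).card := by
  exact_mod_cast (A.nonempty i hi).card_pos

/-- A single vertex covers at most a proportion ε of another block. Hence the minimal sets chosen
later are within ε of failing their covering property. -/
theorem card_hit_le_erase {A : Blockade V} {ε δ : ℝ} (hE : Expands G A ε δ) {i j : ℤ}
    (hi : i ∈ A.index) (hj : j ∈ A.index) (hij : i ≠ j) {P W : Finset V} {p : V} (hp : p ∈ P)
    (hpi : p ∈ A.block i) (hW : W ⊆ A.block j) :
    ((hit G P W).card : ℝ) ≤ (hit G (P.erase p) W).card + ε * (A.block j).card := by
  have h1 : hit G P W = hit G (P.erase p) W ∪ hit G {p} W := by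
    rw [← hit_union]
    congr 1
    ext v
    by_cases h : v = p <;> simp [h, hp]
  have h2 := Finset.card_union_le (hit G (P.erase p) W) (hit G {p} W)
  rw [← h1] at h2
  have h3 := hE.degree i hi j hj hij p hpi W hW
  have h4 : ((hit G P W).card : ℝ) ≤ (hit G (P.erase p) W).card + (hit G {p} W).card := by
    exact_mod_cast h2
  linarith

/-! ### Minimal subsets, and shrinking by a factor m -/

/-- A nonempty set with property `Q` has a minimal subset with property `Q`. -/
theorem exists_minimal_subset {X : Finset V} (Q : Finset V → Prop) (hX : Q X) (h0 : ¬ Q ∅) :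
    ∃ P ⊆ X, Q P ∧ ∃ p ∈ P, ¬ Q (P.erase p) := by
  induction X using Finset.strongInduction with
  | H X ih =>
    have hne : X.Nonempty := by
      rw [Finset.nonempty_iff_ne_empty]
      rintro rfl
      exact h0 hX
    obtain ⟨p, hp⟩ := hne
    by_cases h : Q (X.erase p)
    · obtain ⟨P, hP, h1⟩ := ih _ (Finset.erase_ssubset hp) h
      exact ⟨P, hP.trans (Finset.erase_subset _ _), h1⟩
    · exact ⟨X, subset_rfl, hX, p, hp, h⟩

/-- Cut `S` into `m` pieces of at most `c` elements: by subadditivity the best piece carries at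
least the average. Pieces are removed one at a time. -/
theorem exists_subset_card_le_of_subadditive (f : Finset V → ℕ)
    (hf : ∀ S T, f (S ∪ T) ≤ f S + f T) (c m : ℕ) (hm : 1 ≤ m) (S : Finset V)
    (hS : S.card ≤ m * c) : ∃ S' ⊆ S, S'.card ≤ c ∧ f S ≤ m * f S' := by
  induction m, hm using Nat.le_induction generalizing S with
  | base => exact ⟨S, subset_rfl, by simpa using hS, by simp⟩
  | succ m hm ih =>
    by_cases hc : S.card ≤ c
    · exact ⟨S, subset_rfl, hc, Nat.le_mul_of_pos_left _ (by omega)⟩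
    obtain ⟨S1, h1, h1c⟩ := Finset.exists_subset_card_eq (by omega : c ≤ S.card)
    by_cases h2 : f S ≤ (m + 1) * f S1
    · exact ⟨S1, h1, h1c.le, h2⟩
    have hcard := Finset.card_sdiff_add_card_eq_card h1
    obtain ⟨S2, h3, h4, h5⟩ := ih (S \ S1) (by
      have : (m + 1) * c = m * c + c := by ring
      omega)
    refine ⟨S2, h3.trans Finset.sdiff_subset, h4, ?_⟩
    have h6 : f S ≤ f S1 + f (S \ S1) := by
      have := hf S1 (S \ S1)
      rwa [Finset.union_sdiff_of_subset h1] at this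
    have h7 : m * f S ≤ m * f S1 + m * f (S \ S1) := by nlinarith
    have h8 : m * f (S \ S1) ≤ m * (m * f S2) := Nat.mul_le_mul_left _ h5
    push Not at h2
    by_contra h9
    push Not at h9
    nlinarith

/-- The pieces have size at most (|S| - 1)/m + 1. Measuring by `card - 1` absorbs the rounding, so
the bound iterates without loss: if |S| ≤ m^r, then r shrinkings leave at most one element. -/
theorem exists_shrink (f : Finset V → ℕ) (hf : ∀ S T, f (S ∪ T) ≤ f S + f T) (m : ℕ)
    (hm : 1 ≤ m) (S : Finset V) :
    ∃ S' ⊆ S, (S'.card - 1) * m ≤ S.card - 1 ∧ f S ≤ m * f S' := by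
  have hdiv := Nat.div_add_mod (S.card - 1) m
  have hmod := Nat.mod_lt (S.card - 1) (by omega : 0 < m)
  obtain ⟨S', h1, h2, h3⟩ := exists_subset_card_le_of_subadditive f hf ((S.card - 1) / m + 1) m hm S
    (by rw [mul_add]; omega)
  refine ⟨S', h1, ?_, h3⟩
  calc (S'.card - 1) * m ≤ ((S.card - 1) / m) * m := Nat.mul_le_mul_right _ (Nat.sub_le_of_le_add h2)
    _ ≤ S.card - 1 := Nat.div_mul_le_self _ _

/-! ### Walks of prescribed type -/

/-- `Conn G B u [d₁, …, dₛ] w`: there is a walk from `u` to `w` whose interior vertices lie in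
`B d₁, …, B dₛ`, in this order. -/
def Conn (G : SimpleGraph V) (B : ℤ → Finset V) : V → List ℤ → V → Prop
  | u, [], w => G.Adj u w
  | u, d :: l, w => ∃ v ∈ B d, G.Adj u v ∧ Conn G B v l w

/-- The set of last vertices of walks that start in `S` and then visit `B d`, for `d` in the
list, in this order. -/
noncomputable def reach (G : SimpleGraph V) (B : ℤ → Finset V) (S : Finset V) (l : List ℤ) :
    Finset V := l.foldl (fun T d => hit G T (B d)) S

theorem reach_append (B : ℤ → Finset V) (S : Finset V) (l : List ℤ) (d : ℤ) :
    reach G B S (l ++ [d]) = hit G (reach G B S l) (B d) := by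
  simp [reach]

theorem reach_union (B : ℤ → Finset V) (S T : Finset V) (l : List ℤ) :
    reach G B (S ∪ T) l = reach G B S l ∪ reach G B T l := by
  induction l using List.reverseRecOn with
  | nil => rfl
  | append_singleton l d ih => simp only [reach_append, ih, hit_union]

theorem reach_empty (B : ℤ → Finset V) (l : List ℤ) : reach G B ∅ l = ∅ := by
  induction l using List.reverseRecOn with
  | nil => rfl
  | append_singleton l d ih => simp only [reach_append, ih, hit_empty]

theorem exists_conn_of_adj_reach {B : ℤ → Finset V} {l : List ℤ} {S : Finset V} {v w : V}
    (hv : v ∈ reach G B S l) (hw : G.Adj v w) : ∃ s ∈ S, Conn G B s l w := by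
  induction l generalizing S with
  | nil => exact ⟨v, hv, hw⟩
  | cons d l ih =>
    obtain ⟨s, hs, h⟩ := ih (S := hit G S (B d)) hv
    obtain ⟨h1, p, hp, h2⟩ := mem_hit.1 hs
    exact ⟨p, hp, s, h1, h2, h⟩

/-- The current end set has proportion δ, so it covers more than a proportion ε of the next block;
since δm ≤ ε, the starting set can be shrunk by a factor `m` and its image still has proportion δ.
The index `i` stands for the last block visited. -/
theorem Expands.exists_reach [Fintype V] {A : Blockade V} {ε δ : ℝ} (hE : Expands G A ε δ)
    (hδ : 0 < δ) {m : ℕ} (hm : 1 ≤ m) (hδm : δ * m ≤ ε) {B : ℤ → Finset V} {i₀ : ℤ}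
    (hi₀ : i₀ ∈ A.index) {S : Finset V} (hS : S ⊆ A.block i₀)
    (hcard : δ * (A.block i₀).card ≤ S.card) (l : List ℤ) (hl : (i₀ :: l).Nodup)
    (hlA : ∀ d ∈ l, d ∈ A.index ∧ B d ⊆ A.block d ∧ 2 * ε * (A.block d).card ≤ (B d).card) :
    ∃ S' ⊆ S, (S'.card - 1) * m ^ l.length < Fintype.card V ∧ ∃ i ∈ i₀ :: l,
      reach G B S' l ⊆ A.block i ∧ δ * (A.block i).card ≤ (reach G B S' l).card := by
  induction l using List.reverseRecOn with
  | nil =>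
    refine ⟨S, subset_rfl, ?_, i₀, by simp, hS, hcard⟩
    have h1 : (0 : ℝ) < S.card := lt_of_lt_of_le (mul_pos hδ (A.card_block_pos hi₀)) hcard
    have h2 : 0 < S.card := by exact_mod_cast h1
    have h3 : S.card ≤ Fintype.card V := Finset.card_le_univ S
    simp only [List.length_nil, pow_zero, mul_one]
    omega
  | append_singleton l d ih =>
    have hl' : (i₀ :: l).Nodup := by
      rw [← List.cons_append] at hl
      exact (List.nodup_append.1 hl).1
    have hd : d ∉ i₀ :: l := by
      rw [← List.cons_append] at hl
      intro h
      exact (List.nodup_append.1 hl).2.2 d h d (by simp) rfl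
    obtain ⟨S', h1, h2, i, h3, h4, h5⟩ := ih hl' fun e he => hlA e (by simp [he])
    obtain ⟨hdA, hdB, hdc⟩ := hlA d (by simp)
    have hiA : i ∈ A.index := by
      rcases List.mem_cons.1 h3 with rfl | h
      · exact hi₀
      · exact (hlA i (by simp [h])).1
    have hid : i ≠ d := fun h => hd (h ▸ h3)
    obtain ⟨S'', g1, g2, g3⟩ := exists_shrink (fun T => (reach G B T (l ++ [d])).card)
      (fun T U => by simp only [reach_union]; exact Finset.card_union_le _ _) m hm S'
    refine ⟨S'', g1.trans h1, ?_, d, by simp, ?_, ?_⟩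
    · calc (S''.card - 1) * m ^ (l ++ [d]).length = ((S''.card - 1) * m) * m ^ l.length := by
            simp only [List.length_append, List.length_singleton]; ring
        _ ≤ (S'.card - 1) * m ^ l.length := Nat.mul_le_mul_right _ g2
        _ < _ := h2
    · rw [reach_append]
      exact (hit_subset _ _).trans hdB
    · have k1 := hE.expand i hiA d hdA hid _ h4 h5 (B d) hdB
      have k2 := card_hit_add_card_sdiff (G := G) (reach G B S' l) (B d)
      rw [← reach_append] at k1 k2
      have k3 : ((reach G B S' (l ++ [d])).card : ℝ) ≤ m * (reach G B S'' (l ++ [d])).card := by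
        exact_mod_cast g3
      have hA := A.card_block_pos hdA
      have hm' : (0 : ℝ) < m := by exact_mod_cast (by omega : 0 < m)
      have k4 : δ * m * (A.block d).card ≤ ε * (A.block d).card :=
        mul_le_mul_of_nonneg_right hδm hA.le
      have k5 : m * (δ * (A.block d).card) ≤ m * ((reach G B S'' (l ++ [d])).card : ℝ) := by
        linarith
      exact le_of_mul_le_mul_left k5 hm'

/-- Every set of proportion `δ` contains a vertex from which walks through the given blocks reach
almost all of every other block. -/
theorem Expands.exists_conn [Fintype V] {A : Blockade V} {ε δ : ℝ} (hE : Expands G A ε δ)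
    (hδ : 0 < δ) {m : ℕ} (hm : 1 ≤ m) (hδm : δ * m ≤ ε) {B : ℤ → Finset V} {i₀ : ℤ}
    (hi₀ : i₀ ∈ A.index) {S : Finset V} (hS : S ⊆ A.block i₀)
    (hcard : δ * (A.block i₀).card ≤ S.card) (l : List ℤ) (hl : (i₀ :: l).Nodup)
    (hlA : ∀ d ∈ l, d ∈ A.index ∧ B d ⊆ A.block d ∧ 2 * ε * (A.block d).card ≤ (B d).card)
    (hml : Fintype.card V ≤ m ^ l.length) :
    ∃ s ∈ S, ∀ j ∈ A.index, j ∉ i₀ :: l → ∀ W ⊆ A.block j,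
      ((W.filter fun w => ¬ Conn G B s l w).card : ℝ) < ε * (A.block j).card := by
  obtain ⟨S', h1, h2, i, h3, h4, h5⟩ := hE.exists_reach hδ hm hδm hi₀ hS hcard l hl hlA
  have hiA : i ∈ A.index := by
    rcases List.mem_cons.1 h3 with rfl | h
    · exact hi₀
    · exact (hlA i h).1
  have hne : S'.Nonempty := by
    rw [Finset.nonempty_iff_ne_empty]
    rintro rfl
    rw [reach_empty] at h5
    have := mul_pos hδ (A.card_block_pos hiA)
    simp at h5
    linarith
  -- `hml` leaves no room for a second starting vertex.
  have hc1 : S'.card ≤ 1 := by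
    by_contra h
    have : 1 ≤ S'.card - 1 := by omega
    have : 1 * m ^ l.length ≤ (S'.card - 1) * m ^ l.length := Nat.mul_le_mul_right _ this
    omega
  obtain ⟨s, hs⟩ := hne
  refine ⟨s, h1 hs, fun j hj hjl W hW => ?_⟩
  have hij : i ≠ j := fun h => hjl (h ▸ h3)
  refine lt_of_le_of_lt ?_ (hE.expand i hiA j hj hij _ h4 h5 W hW)
  have : (W.filter fun w => ¬ Conn G B s l w) ⊆ W \ hit G (reach G B S' l) W := by
    intro w hw
    rw [Finset.mem_filter] at hw
    rw [Finset.mem_sdiff]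
    refine ⟨hw.1, fun hh => hw.2 ?_⟩
    obtain ⟨_, v, hv, hvw⟩ := mem_hit.1 hh
    obtain ⟨s', hs', hc⟩ := exists_conn_of_adj_reach hv hvw
    rwa [Finset.card_le_one.1 hc1 s hs s' hs']
  exact_mod_cast Finset.card_le_card this

end

/-! ### Shortest walks and the levels they form -/

section
open scoped Classical

variable {V : Type*} {G : SimpleGraph V} {B : ℤ → Finset V}

theorem conn_append {s t : List ℤ} {d : ℤ} {u w : V} :
    Conn G B u (s ++ d :: t) w ↔ ∃ v ∈ B d, Conn G B u s v ∧ Conn G B v t w := by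
  induction s generalizing u with
  | nil => rfl
  | cons e s ih =>
    simp only [List.cons_append, Conn, ih]
    constructor
    · rintro ⟨v, hv, h, v', hv', h1, h2⟩
      exact ⟨v', hv', ⟨v, hv, h, h1⟩, h2⟩
    · rintro ⟨v', hv', ⟨v, hv, h, h1⟩, h2⟩
      exact ⟨v, hv, h, v', hv', h1, h2⟩

theorem Conn.mono {B' : ℤ → Finset V} {l : List ℤ} {u w : V} (h : Conn G B u l w)
    (hB : ∀ d ∈ l, B d ⊆ B' d) : Conn G B' u l w := by
  induction l generalizing u with
  | nil => exact h
  | cons d l ih =>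
    obtain ⟨v, hv, h1, h2⟩ := h
    exact ⟨v, hB d (by simp) hv, h1, ih h2 fun e he => hB e (by simp [he])⟩

/-- A walk can be recorded as a choice of one vertex in each of the sets it visits. -/
theorem Conn.exists_path {l : List ℤ} {u w : V} (h : Conn G B u l w) (hl : l.Nodup) :
    ∃ p : ℤ → V, (∀ d ∈ l, p d ∈ B d) ∧ Conn G (fun d => {p d}) u l w := by
  induction l generalizing u with
  | nil => exact ⟨fun _ => u, by simp, h⟩
  | cons d l ih =>
    obtain ⟨v, hv, h1, h2⟩ := h
    rw [List.nodup_cons] at hl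
    obtain ⟨p, hp, hc⟩ := ih h2 hl.2
    have hne : ∀ e ∈ l, Function.update p d v e = p e := fun e he =>
      Function.update_of_ne (fun h : e = d => hl.1 (h ▸ he)) _ _
    refine ⟨Function.update p d v, ?_, v, by simp, h1, hc.mono fun e he => by rw [hne e he]⟩
    intro e he
    rcases List.mem_cons.1 he with rfl | he
    · simpa using hv
    · rw [hne e he]
      exact hp e he

/-- `t` is a shortest sublist of `Λ` such that some walk from `q` to `w` has type `t`. -/
structure MinConn (G : SimpleGraph V) (B : ℤ → Finset V) (q : V) (Λ t : List ℤ) (w : V) :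
    Prop where
  sublist : t.Sublist Λ
  conn : Conn G B q t w
  le_length : ∀ t' : List ℤ, t'.Sublist Λ → Conn G B q t' w → t.length ≤ t'.length

theorem exists_minConn {q w : V} {Λ t : List ℤ} (ht : t.Sublist Λ) (h : Conn G B q t w) :
    ∃ t', MinConn G B q Λ t' w := by
  obtain ⟨t', h1, h2⟩ := exists_minimalFor_of_wellFoundedLT
    (fun t : List ℤ => t.Sublist Λ ∧ Conn G B q t w) List.length ⟨t, ht, h⟩
  refine ⟨t', h1.1, h1.2, fun s hs hc => ?_⟩
  by_contra hlt
  exact hlt (h2 ⟨hs, hc⟩ (by omega))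

/-- The vertices at position `a` on walks of type `t` from `q` to `C`. -/
noncomputable def walkLevel (G : SimpleGraph V) (B : ℤ → Finset V) (q : V) (t : List ℤ)
    (C : Finset V) : ℕ → Finset V
  | 0 => {q}
  | a + 1 => (B (t.getD a 0)).filter fun v =>
      Conn G B q (t.take a) v ∧ ∃ w ∈ C, Conn G B v (t.drop (a + 1)) w

section WalkLevel

variable {q : V} {t : List ℤ} {C : Finset V}

theorem mem_walkLevel_succ {a : ℕ} {v : V} : v ∈ walkLevel G B q t C (a + 1) ↔
    v ∈ B (t.getD a 0) ∧ Conn G B q (t.take a) v ∧ ∃ w ∈ C, Conn G B v (t.drop (a + 1)) w := by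
  simp [walkLevel]

theorem take_succ_getD {a : ℕ} (ha : a < t.length) :
    t.take (a + 1) = t.take a ++ [t.getD a 0] := by
  rw [List.take_succ_eq_append_getElem ha, List.getD_eq_getElem _ _ ha]

theorem drop_getD {a : ℕ} (ha : a < t.length) : t.drop a = t.getD a 0 :: t.drop (a + 1) := by
  rw [List.drop_eq_getElem_cons ha, List.getD_eq_getElem _ _ ha]

theorem conn_of_mem_walkLevel {a : ℕ} (ha : a ≤ t.length) {v u : V}
    (hv : v ∈ walkLevel G B q t C a) (h : G.Adj v u) : Conn G B q (t.take a) u := by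
  cases a with
  | zero =>
    simp only [walkLevel, Finset.mem_singleton] at hv
    subst hv
    simpa [Conn] using h
  | succ a =>
    rw [mem_walkLevel_succ] at hv
    rw [take_succ_getD (by omega), conn_append]
    exact ⟨v, hv.1, hv.2.1, h⟩

theorem covers_walkLevel {a : ℕ} (ha : a < t.length) :
    Covers G (walkLevel G B q t C a) (walkLevel G B q t C (a + 1)) := by
  intro v hv
  rw [mem_walkLevel_succ] at hv
  obtain ⟨hvB, hc, w, hw, hvw⟩ := hv
  cases a with
  | zero => exact ⟨q, by simp [walkLevel], by simpa [Conn] using hc⟩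
  | succ a =>
    rw [take_succ_getD (by omega), conn_append] at hc
    obtain ⟨u, hu, h1, h2⟩ := hc
    refine ⟨u, mem_walkLevel_succ.2 ⟨hu, h1, w, hw, ?_⟩, h2⟩
    rw [drop_getD ha]
    exact ⟨v, hvB, h2, hvw⟩

theorem covers_walkLevel_length (hC : ∀ w ∈ C, Conn G B q t w) :
    Covers G (walkLevel G B q t C t.length) C := by
  intro w hw
  have h := hC w hw
  rcases Nat.eq_zero_or_pos t.length with h0 | h0
  · rw [List.length_eq_zero_iff] at h0
    subst h0
    exact ⟨q, by simp [walkLevel], h⟩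
  · obtain ⟨a, ha⟩ : ∃ a, t.length = a + 1 := ⟨t.length - 1, by omega⟩
    rw [← List.take_append_drop a t, drop_getD (by omega), conn_append] at h
    obtain ⟨v, hv, h1, h2⟩ := h
    rw [ha]
    refine ⟨v, mem_walkLevel_succ.2 ⟨hv, h1, w, hw, h2⟩, ?_⟩
    rw [List.drop_eq_nil_of_le ha.le] at h2
    exact h2

theorem sublist_take_append_drop {a b : ℕ} (hab : a ≤ b) :
    (t.take a ++ t.drop b).Sublist t := by
  conv_rhs => rw [← List.take_append_drop a t]
  exact List.Sublist.append (List.Sublist.refl _) (List.drop_sublist_drop_left t hab)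

variable {Λ : List ℤ}

/-- An edge skipping a level would shorten a walk to a target: its type becomes `t.take a` followed
by `t.drop (b - 1)`, a shorter sublist of `Λ`. This is why minimality is taken over all sublists. -/
theorem anticomplete_walkLevel (hC : ∀ w ∈ C, MinConn G B q Λ t w) {a b : ℕ} (hab : a + 2 ≤ b)
    (hb : b ≤ t.length) :
    Anticomplete G (walkLevel G B q t C a) (walkLevel G B q t C b) := by
  intro v hv v' hv' hadj
  obtain ⟨b, rfl⟩ : ∃ b', b = b' + 1 := ⟨b - 1, by omega⟩
  obtain ⟨hvB, hc, w, hw, hvw⟩ := mem_walkLevel_succ.1 hv'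
  have h1 := conn_of_mem_walkLevel (by omega) hv hadj
  have h2 : Conn G B q (t.take a ++ t.drop b) w := by
    rw [drop_getD (by omega), conn_append]
    exact ⟨v', hvB, h1, hvw⟩
  have h3 := (hC w hw).le_length _
    ((sublist_take_append_drop (by omega)).trans (hC w hw).sublist) h2
  simp only [List.length_append, List.length_take, List.length_drop] at h3
  omega

theorem anticomplete_walkLevel_target (hC : ∀ w ∈ C, MinConn G B q Λ t w) {a : ℕ}
    (ha : a < t.length) : Anticomplete G (walkLevel G B q t C a) C := by
  intro v hv w hw hadj
  have h1 := conn_of_mem_walkLevel ha.le hv hadj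
  have h3 := (hC w hw).le_length _ ((List.take_sublist _ _).trans (hC w hw).sublist) h1
  simp only [List.length_take] at h3
  omega

end WalkLevel

end

/-! ### Separating two sets that cover the same targets -/

section
open scoped Classical

variable {V : Type*} {G : SimpleGraph V} {A : Blockade V} {ε δ : ℝ}

theorem card_le_card_hit_sdiff_add (W H S : Finset V) :
    ((hit G W S).card : ℝ) ≤ (hit G W (S \ H)).card + H.card := by
  have h1 : hit G W S ⊆ hit G W (S \ H) ∪ H := by
    intro v hv
    rw [mem_hit] at hv
    rw [Finset.mem_union, mem_hit, Finset.mem_sdiff]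
    by_cases h : v ∈ H
    · exact Or.inr h
    · exact Or.inl ⟨⟨hv.1, h⟩, hv.2⟩
  exact_mod_cast (Finset.card_le_card h1).trans (Finset.card_union_le _ _)

theorem card_le_card_sdiff_add (S H : Finset V) :
    (S.card : ℝ) ≤ (S \ H).card + H.card := by
  have h1 : S ⊆ (S \ H) ∪ H := by
    intro v hv
    rw [Finset.mem_union, Finset.mem_sdiff]
    tauto
  exact_mod_cast (Finset.card_le_card h1).trans (Finset.card_union_le _ _)

/-- Two sets `U`, `W` cover many sets `C j`. Parts of them can be chosen so that one `C x` has a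
large part that is covered by the part of `W` and missed by the part of `U`, while many others have
large parts that are covered by the part of `U` and missed by the part of `W`. -/
theorem Expands.exists_separation [Fintype V] (hE : Expands G A ε δ) (hδ : 0 < δ) {m : ℕ}
    (hm : 1 ≤ m) (hδm : δ * m ≤ ε) {r : ℕ} (hml : Fintype.card V ≤ m ^ r)
    {C : ℤ → Finset V} {κ : ℝ} (hκ : 4 * (r + 1) * (r + 2) * ε ≤ κ) (g : ℕ)
    {p q : ℤ} (hp : p ∈ A.index) (hq : q ∈ A.index) {U : Finset V} (hU : U ⊆ A.block p)
    (k t : ℕ) (hkt : t + k = r) (W : Finset V) (hW : W ⊆ A.block q)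
    (hWc : (W.card - 1) * m ^ t < Fintype.card V) (J : Finset ℤ) (hJ : k * g + 1 ≤ J.card)
    (hJA : ∀ j ∈ J, j ∈ A.index ∧ j ≠ p ∧ j ≠ q ∧ C j ⊆ A.block j ∧
      κ * (A.block j).card ≤ (C j).card ∧ Covers G U (C j))
    (hJW : ∀ j ∈ J, (1 - t / (r + 1)) * ((C j).card : ℝ) ≤ (hit G W (C j)).card) :
    ∃ P ⊆ U, ∃ Q ⊆ W, ∃ x ∈ J, ∃ X ⊆ C x, Anticomplete G P X ∧ Covers G Q X ∧
      δ * (A.block x).card ≤ X.card ∧ ∃ I ⊆ J.erase x, g ≤ I.card ∧ ∀ i ∈ I,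
        (1 / (r + 1) - 1 / (2 * (r + 1) * (r + 2))) * ((C i).card : ℝ) ≤
          (hit G P (C i) \ hit G Q (C i)).card := by
  have hm' : (0 : ℝ) < m := by exact_mod_cast hm
  have hε : 0 < ε := lt_of_lt_of_le (mul_pos hδ hm') hδm
  have hρ : (0 : ℝ) < r + 1 := by positivity
  have hx : (0 : ℝ) < r + 2 := by positivity
  have hκ0 : 0 < κ := lt_of_lt_of_le (by positivity) hκ
  have hCpos : ∀ j ∈ J, (0 : ℝ) < (C j).card := fun j hj =>
    lt_of_lt_of_le (mul_pos hκ0 (A.card_block_pos (hJA j hj).1)) (hJA j hj).2.2.2.2.1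
  -- At stage `t` the set `W` has been shrunk `t` times by the factor `m` and still covers a
  -- proportion at least 1 - t/(r+1) of each remaining target; `k` counts the stages left.
  induction k generalizing t W J with
  | zero =>
    -- After r stages `W` has at most one vertex, which cannot cover a proportion 1/(r+1) of a
    -- target.
    exfalso
    obtain ⟨j, hj⟩ : J.Nonempty := Finset.card_pos.1 (by omega)
    obtain ⟨hjA, hjp, hjq, hCj, hc, _⟩ := hJA j hj
    have htr : t = r := by omega
    subst htr
    have hW1 : W.card ≤ 1 := by
      by_contra hh
      have : 1 * m ^ t ≤ (W.card - 1) * m ^ t := Nat.mul_le_mul_right _ (by omega)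
      omega
    have hA := A.card_block_pos hjA
    have h1 : ((hit G W (C j)).card : ℝ) ≤ ε * (A.block j).card := by
      rcases Finset.eq_empty_or_nonempty W with rfl | ⟨v, hv⟩
      · rw [hit_empty]
        simp only [Finset.card_empty, Nat.cast_zero]
        positivity
      · have : W = {v} := Finset.eq_singleton_iff_unique_mem.2
          ⟨hv, fun w hw => Finset.card_le_one.1 hW1 w hw v hv⟩
        rw [this]
        exact hE.degree q hq j hjA (Ne.symm hjq) v (hW hv) _ hCj
    have h2 := hJW j hj
    have h3 : (1 - (t : ℝ) / (t + 1)) = 1 / (t + 1) := by field_simp; ring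
    rw [h3] at h2
    have h4 : κ * (A.block j).card / (t + 1) ≤ ε * (A.block j).card := by
      calc κ * (A.block j).card / (t + 1) ≤ (C j).card / (t + 1) := by gcongr
        _ = 1 / (t + 1) * (C j).card := by ring
        _ ≤ _ := h2.trans h1
    rw [div_le_iff₀ hρ] at h4
    have h5 : κ ≤ ε * (t + 1) := by
      by_contra hh
      push Not at hh
      have := mul_lt_mul_of_pos_right hh hA
      nlinarith
    have h6 : (0 : ℝ) ≤ t := by positivity
    nlinarith [mul_pos hε hρ]
  | succ k ih =>
    -- `P` is minimal for covering slightly less than `W` is known to cover. At the target `x` where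
    -- `P` is about to fail, this margin, worth 2ε of the block, leaves a part `X₀` of proportion ε
    -- covered by `W` and missed by `P`.
    set a : ℝ := t / (r + 1) + 1 / (2 * (r + 1) * (r + 2)) with ha
    have htr : (t : ℝ) + 1 ≤ r := by exact_mod_cast (by omega : t + 1 ≤ r)
    have ha1 : a < 1 := by
      rw [ha, div_add_div _ _ (by positivity) (by positivity), div_lt_one (by positivity)]
      have : (0 : ℝ) ≤ t := by positivity
      nlinarith [mul_pos hρ hx]
    have ha0 : 0 ≤ a := by positivity
    have hJne : J.Nonempty := Finset.card_pos.1 (by omega)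
    obtain ⟨P, hPU, hP, u, hu, hPu⟩ := exists_minimal_subset (X := U)
      (fun P => ∀ i ∈ J, (1 - a) * ((C i).card : ℝ) ≤ (hit G P (C i)).card)
      (by
        intro i hi
        rw [hit_eq_of_covers (hJA i hi).2.2.2.2.2]
        nlinarith [hCpos i hi])
      (by
        obtain ⟨j, hj⟩ := hJne
        intro hh
        have := hh j hj
        rw [hit_empty] at this
        simp only [Finset.card_empty, Nat.cast_zero] at this
        nlinarith [hCpos j hj])
    push Not at hPu
    obtain ⟨x, hxJ, hPx⟩ := hPu
    obtain ⟨hxA, hxp, hxq, hCx, hcx, hUx⟩ := hJA x hxJ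
    have hAx := A.card_block_pos hxA
    set X₀ := hit G W (C x \ hit G P (C x)) with hX₀
    have hX₀C : X₀ ⊆ C x := (hit_subset _ _).trans Finset.sdiff_subset
    have hX₀card : ε * (A.block x).card ≤ X₀.card := by
      have h1 := card_hit_le_erase hE hp hxA (Ne.symm hxp) hu (hU (hPU hu)) hCx
      have h2 := card_le_card_hit_sdiff_add (G := G) W (hit G P (C x)) (C x)
      have h3 := hJW x hxJ
      have h4 : (2 * ε) * (A.block x).card ≤ 1 / (2 * (r + 1) * (r + 2)) * (C x).card := by
        rw [one_div, ← div_eq_inv_mul, le_div_iff₀ (by positivity)]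
        calc 2 * ε * (A.block x).card * (2 * (r + 1) * (r + 2))
            = (4 * (r + 1) * (r + 2) * ε) * (A.block x).card := by ring
          _ ≤ κ * (A.block x).card := by gcongr
          _ ≤ _ := hcx
      have h5 : (1 - (t : ℝ) / (r + 1)) * ((C x).card : ℝ) - (1 - a) * (C x).card =
          1 / (2 * (r + 1) * (r + 2)) * (C x).card := by rw [ha]; ring
      linarith
    obtain ⟨Q, hQW, hQc, hQf⟩ := exists_shrink (fun T => (hit G T X₀).card)
      (fun S T => by simp only [hit_union]; exact Finset.card_union_le _ _) m hm W
    have hWX : hit G W X₀ = X₀ := hit_eq_of_covers (covers_hit _ _)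
    simp only [hWX] at hQf
    set X := hit G Q X₀ with hX
    have hXcard : δ * (A.block x).card ≤ X.card := by
      have h1 : (X₀.card : ℝ) ≤ m * X.card := by exact_mod_cast hQf
      have h2 : δ * m * (A.block x).card ≤ ε * (A.block x).card :=
        mul_le_mul_of_nonneg_right hδm hAx.le
      have h3 : m * (δ * (A.block x).card) ≤ m * (X.card : ℝ) := by linarith
      exact le_of_mul_le_mul_left h3 hm'
    have hPX : Anticomplete G P X :=
      (anticomplete_sdiff_hit P (C x)).mono subset_rfl
        ((hit_subset _ _).trans (hit_subset _ _))
    -- If `Q` covers little of at least `g` targets, the comparison with `P` finishes. Otherwise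
    -- fewer than `g` targets are discarded besides `x`, and the argument continues with `Q` in
    -- place of `W`.
    set bad := (J.erase x).filter fun i =>
      (1 - ((t + 1 : ℕ) : ℝ) / (r + 1)) * ((C i).card : ℝ) ≤ (hit G Q (C i)).card with hbad
    set good := (J.erase x).filter fun i =>
      ¬ (1 - ((t + 1 : ℕ) : ℝ) / (r + 1)) * ((C i).card : ℝ) ≤ (hit G Q (C i)).card with hgood
    have hsum : bad.card + good.card = J.card - 1 := by
      rw [hbad, hgood, Finset.card_filter_add_card_filter_not, Finset.card_erase_of_mem hxJ]
    by_cases hg : g ≤ good.card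
    · refine ⟨P, hPU, Q, hQW, x, hxJ, X, (hit_subset _ _).trans hX₀C, hPX, covers_hit _ _, hXcard,
        good, Finset.filter_subset _ _, hg, fun i hi => ?_⟩
      obtain ⟨hi1, hi2⟩ := Finset.mem_filter.1 hi
      push Not at hi2
      have h1 := hP i (Finset.mem_of_mem_erase hi1)
      have h2 := card_le_card_sdiff_add (hit G P (C i)) (hit G Q (C i))
      have h3 : (1 / ((r : ℝ) + 1) - 1 / (2 * (r + 1) * (r + 2))) * ((C i).card : ℝ) =
          (1 - a) * (C i).card - (1 - ((t + 1 : ℕ) : ℝ) / (r + 1)) * (C i).card := by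
        rw [ha]; push_cast; ring
      linarith
    · have hbJ : bad ⊆ J := (Finset.filter_subset _ _).trans (Finset.erase_subset _ _)
      have hmul : (k + 1) * g = k * g + g := by ring
      obtain ⟨P', h1, Q', h2, x', h3, X', h4, h5, h6, h7, I, h8, h9⟩ := ih (t + 1) (by omega) Q
        (hQW.trans hW) (by
          calc (Q.card - 1) * m ^ (t + 1) = ((Q.card - 1) * m) * m ^ t := by ring
            _ ≤ (W.card - 1) * m ^ t := Nat.mul_le_mul_right _ hQc
            _ < _ := hWc) bad (by omega) (fun j hj => hJA j (hbJ hj))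
        (fun j hj => (Finset.mem_filter.1 hj).2) (fun j hj => hCpos j (hbJ hj))
      exact ⟨P', h1, Q', h2.trans hQW, x', hbJ h3, X', h4, h5, h6, h7, I,
        h8.trans (Finset.erase_subset_erase _ hbJ), h9⟩

end

/-! ### Two-sided levellings and how to lengthen them -/

section
open scoped Classical

variable {V : Type*} {G : SimpleGraph V} {A : Blockade V} {ε δ : ℝ}

/-- A bi-levelling written as a single sequence `N (-h), …, N 0, …, N m`, with apex `N 0`, whose
two ends both cover the sets `C j`; the set `N i` lies in the block of `A` with index `a i`. -/
structure TwoSided (G : SimpleGraph V) (A : Blockade V) (h m : ℕ) (N : ℤ → Finset V) (a : ℤ → ℤ)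
    (J : Finset ℤ) (C : ℤ → Finset V) : Prop where
  left_pos : 1 ≤ h
  right_pos : 1 ≤ m
  card_zero : (N 0).card = 1
  covers_right : ∀ i : ℤ, 0 ≤ i → i < m → Covers G (N i) (N (i + 1))
  covers_left : ∀ i : ℤ, -h < i → i ≤ 0 → Covers G (N i) (N (i - 1))
  anticomplete : ∀ i j : ℤ, -h ≤ i → i + 2 ≤ j → j ≤ m → Anticomplete G (N i) (N j)
  covers_first : ∀ j ∈ J, Covers G (N (-h)) (C j)
  covers_last : ∀ j ∈ J, Covers G (N m) (C j)
  anticomplete_target : ∀ i : ℤ, -h < i → i < m → ∀ j ∈ J, Anticomplete G (N i) (C j)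
  subset_block : ∀ i : ℤ, -h ≤ i → i ≤ m → a i ∈ A.index ∧ N i ⊆ A.block (a i) ∧ a i ∉ J
  injOn : ∀ i j : ℤ, -h ≤ i → i ≤ m → -h ≤ j → j ≤ m → a i = a j → i = j
  target_subset : ∀ j ∈ J, j ∈ A.index ∧ C j ⊆ A.block j

/-- A two-sided levelling can be made longer by one on the right. -/
theorem TwoSided.exists_succ [Fintype V] (hE : Expands G A ε δ) (hδ : 0 < δ) {m' : ℕ}
    (hm : 1 ≤ m') (hδm : δ * m' ≤ ε) {r : ℕ} (hml : Fintype.card V ≤ m' ^ r)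
    {C : ℤ → Finset V} {κ : ℝ} (hκ : 4 * (r + 1) * (r + 2) * ε ≤ κ) (g : ℕ)
    {h m : ℕ} {N : ℤ → Finset V} {a : ℤ → ℤ} {J : Finset ℤ} (T : TwoSided G A h m N a J C)
    (hJ : r * g + 1 ≤ J.card) (hC : ∀ j ∈ J, κ * (A.block j).card ≤ (C j).card) :
    ∃ N' a' J' C', TwoSided G A h (m + 1) N' a' J' C' ∧ g ≤ J'.card ∧
      ∀ j ∈ J', κ / (r + 2) * (A.block j).card ≤ (C' j).card := by
  have hh := T.left_pos
  have hmm := T.right_pos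
  obtain ⟨hp, hpN, hpJ⟩ := T.subset_block (-h) le_rfl (by omega)
  obtain ⟨hq, hqN, hqJ⟩ := T.subset_block m (by omega) le_rfl
  have hm' : (0 : ℝ) < m' := by exact_mod_cast hm
  have hε : 0 < ε := lt_of_lt_of_le (mul_pos hδ hm') hδm
  have hκ0 : 0 < κ := lt_of_lt_of_le (by positivity) hκ
  have hne : (Finset.univ : Finset V).Nonempty := by
    obtain ⟨v, hv⟩ := Finset.card_pos.1 (by rw [T.card_zero]; norm_num : 0 < (N 0).card)
    exact ⟨v, Finset.mem_univ _⟩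
  have hcV : 0 < Fintype.card V := by rw [← Finset.card_univ]; exact hne.card_pos
  obtain ⟨P, hPU, Q, hQW, x, hxJ, X, hXC, hPX, hQX, hXc, I, hIJ, hIg, hI⟩ :=
    hE.exists_separation hδ hm hδm hml (C := C) hκ g hp hq hpN r 0 (by omega) (N m) hqN
      (by
        have : (N m).card ≤ Fintype.card V := Finset.card_le_univ _
        simp only [pow_zero, mul_one]
        omega) J hJ
      (fun j hj => ⟨(T.target_subset j hj).1, fun e => hpJ (e ▸ hj), fun e => hqJ (e ▸ hj),
        (T.target_subset j hj).2, hC j hj, T.covers_first j hj⟩)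
      (fun j hj => by rw [hit_eq_of_covers (T.covers_last j hj)]; simp)
  have hIJ' : ∀ i ∈ I, i ∈ J ∧ i ≠ x := fun i hi =>
    ⟨Finset.mem_of_mem_erase (hIJ hi), Finset.ne_of_mem_erase (hIJ hi)⟩
  obtain ⟨hxA, hxC⟩ := T.target_subset x hxJ
  -- Only the ends change: the first level shrinks to `P`, the last to `Q`, and `X` is appended. `P`
  -- misses `X`, so the first level sees no edge to the new one.
  set N' : ℤ → Finset V := fun i =>
    if i = m + 1 then X else if i = m then Q else if i = -h then P else N i with hN'
  have hN'sub : ∀ i : ℤ, i ≤ m → N' i ⊆ N i := by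
    intro i hi
    simp only [hN']
    rw [if_neg (by omega)]
    split_ifs with h1 h2
    · rw [h1]; exact hQW
    · rw [h2]; exact hPU
    · exact subset_rfl
  have hN'mid : ∀ i : ℤ, -h < i → i < m → N' i = N i := by
    intro i h1 h2
    simp only [hN']
    rw [if_neg (by omega), if_neg (by omega), if_neg (by omega)]
  have hN'last : N' (m + 1) = X := by simp [hN']
  have hN'm : N' m = Q := by simp [hN']
  have hN'h : N' (-h) = P := by
    simp only [hN']
    rw [if_neg (by omega), if_neg (by omega)]
    simp
  set a' : ℤ → ℤ := fun i => if i = m + 1 then x else a i with ha'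
  have ha'of : ∀ i : ℤ, i ≤ m → a' i = a i := fun i hi => if_neg (by omega)
  have ha'last : a' (m + 1) = x := by simp [ha']
  -- `X` has proportion δ, so it covers almost all of the part of each target that `P` covers and
  -- `Q` misses.
  set C' : ℤ → Finset V := fun i => hit G X (hit G P (C i) \ hit G Q (C i)) with hC'
  have hC'sub : ∀ i, C' i ⊆ C i := fun i =>
    (hit_subset _ _).trans (Finset.sdiff_subset.trans (hit_subset _ _))
  refine ⟨N', a', I, C', ?_, hIg, ?_⟩
  · refine ⟨hh, by omega, ?_, ?_, ?_, ?_, ?_, ?_, ?_, ?_, ?_, ?_⟩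
    · rw [hN'mid 0 (by omega) (by omega)]
      exact T.card_zero
    · intro i h1 h2
      push_cast at h2
      rcases eq_or_lt_of_le (by omega : i ≤ m) with rfl | h3
      · rw [hN'm, hN'last]
        exact hQX
      · rw [hN'mid i (by omega) h3]
        exact (T.covers_right i h1 h3).mono (hN'sub _ (by omega))
    · intro i h1 h2
      rw [hN'mid i h1 (by omega)]
      exact (T.covers_left i h1 h2).mono (hN'sub _ (by omega))
    · intro i j h1 h2 h3
      push_cast at h3
      rcases eq_or_lt_of_le h3 with rfl | h4
      · rw [hN'last]
        rcases eq_or_lt_of_le h1 with rfl | h5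
        · rw [hN'h]
          exact hPX
        · rw [hN'mid i h5 (by omega)]
          exact (T.anticomplete_target i h5 (by omega) x hxJ).mono subset_rfl hXC
      · exact (T.anticomplete i j h1 h2 (by omega)).mono (hN'sub _ (by omega))
          (hN'sub _ (by omega))
    · intro j hj
      rw [hN'h]
      exact (covers_hit P (C j)).mono ((hit_subset _ _).trans Finset.sdiff_subset)
    · intro j hj
      push_cast
      rw [hN'last]
      exact covers_hit _ _
    · intro i h1 h2 j hj
      push_cast at h2
      rcases eq_or_lt_of_le (by omega : i ≤ m) with rfl | h3
      · rw [hN'm]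
        refine (anticomplete_sdiff_hit Q (C j)).mono subset_rfl ((hit_subset _ _).trans ?_)
        exact Finset.sdiff_subset_sdiff (hit_subset _ _) subset_rfl
      · rw [hN'mid i h1 h3]
        exact (T.anticomplete_target i h1 h3 j (hIJ' j hj).1).mono subset_rfl (hC'sub j)
    · intro i h1 h2
      push_cast at h2
      rcases eq_or_lt_of_le h2 with rfl | h3
      · rw [ha'last, hN'last]
        exact ⟨hxA, hXC.trans hxC, fun hxI => (hIJ' x hxI).2 rfl⟩
      · rw [ha'of i (by omega)]
        obtain ⟨k1, k2, k3⟩ := T.subset_block i h1 (by omega)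
        exact ⟨k1, (hN'sub i (by omega)).trans k2, fun hi => k3 (hIJ' _ hi).1⟩
    · intro i j h1 h2 h3 h4 h5
      push_cast at h2 h4
      rcases eq_or_lt_of_le h2 with rfl | h6
      · rcases eq_or_lt_of_le h4 with rfl | h7
        · rfl
        · rw [ha'last, ha'of j (by omega)] at h5
          exact absurd (h5 ▸ hxJ) (T.subset_block j h3 (by omega)).2.2
      · rcases eq_or_lt_of_le h4 with rfl | h7
        · rw [ha'last, ha'of i (by omega)] at h5
          exact absurd (h5 ▸ hxJ) (T.subset_block i h1 (by omega)).2.2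
        · rw [ha'of j (by omega), ha'of i (by omega)] at h5
          exact T.injOn i j h1 (by omega) h3 (by omega) h5
    · intro j hj
      obtain ⟨k1, k2⟩ := T.target_subset j (hIJ' j hj).1
      exact ⟨k1, (hC'sub j).trans k2⟩
  · intro j hj
    obtain ⟨hjJ, hjx⟩ := hIJ' j hj
    obtain ⟨hjA, hjC⟩ := T.target_subset j hjJ
    have h1 := hI j hj
    have h2 := hE.expand x hxA j hjA (Ne.symm hjx) X (hXC.trans hxC) hXc
      (hit G P (C j) \ hit G Q (C j)) (Finset.sdiff_subset.trans ((hit_subset _ _).trans hjC))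
    have h3 := card_hit_add_card_sdiff (G := G) X (hit G P (C j) \ hit G Q (C j))
    have h4 := hC j hjJ
    have hA := A.card_block_pos hjA
    have hc : (0 : ℝ) ≤ 1 / (r + 1) - 1 / (2 * (r + 1) * (r + 2)) := by
      rw [sub_nonneg, div_le_div_iff₀ (by positivity) (by positivity)]
      have : (0 : ℝ) ≤ r := by positivity
      nlinarith
    have h5 : (1 / ((r : ℝ) + 1) - 1 / (2 * (r + 1) * (r + 2))) * (κ * (A.block j).card) ≤
        (1 / (r + 1) - 1 / (2 * (r + 1) * (r + 2))) * (C j).card :=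
      mul_le_mul_of_nonneg_left h4 hc
    -- The gap 1/(r+1) - 1/(r+2) is 1/((r+1)(r+2)): half of it was the margin used in the
    -- separation, the other half absorbs ε.
    have h6 : (1 / ((r : ℝ) + 1) - 1 / (2 * (r + 1) * (r + 2))) * κ - ε ≥ κ / (r + 2) := by
      have h7 : (1 / ((r : ℝ) + 1) - 1 / (2 * (r + 1) * (r + 2))) * κ - κ / (r + 2) =
          κ / (2 * (r + 1) * (r + 2)) := by
        field_simp
        ring
      have h8 : 2 * ε ≤ κ / (2 * (r + 1) * (r + 2)) := by
        rw [le_div_iff₀ (by positivity)]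
        linarith
      linarith
    have h9 := mul_le_mul_of_nonneg_right h6.le hA.le
    simp only [hC']
    nlinarith

/-- A two-sided levelling can be lengthened by `e`. -/
theorem TwoSided.exists_add [Fintype V] (hE : Expands G A ε δ) (hδ : 0 < δ) {m' : ℕ}
    (hm : 1 ≤ m') (hδm : δ * m' ≤ ε) {r : ℕ} (hml : Fintype.card V ≤ m' ^ r)
    {φ : ℝ} (hφ : 4 * (r + 1) * ε ≤ φ) {k : ℕ} (hk : 1 ≤ k) (e : ℕ)
    {h m : ℕ} {N : ℤ → Finset V} {a : ℤ → ℤ} {J : Finset ℤ} {C : ℤ → Finset V}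
    (T : TwoSided G A h m N a J C) (hJ : (r + 1) ^ e * k ≤ J.card)
    (hC : ∀ j ∈ J, φ * (r + 2) ^ e * (A.block j).card ≤ (C j).card) :
    ∃ N' a' J' C', TwoSided G A h (m + e) N' a' J' C' ∧ k ≤ J'.card ∧
      ∀ j ∈ J', φ * (A.block j).card ≤ (C' j).card := by
  have hm' : (0 : ℝ) < m' := by exact_mod_cast hm
  have hε : 0 < ε := lt_of_lt_of_le (mul_pos hδ hm') hδm
  have hφ0 : 0 < φ := lt_of_lt_of_le (by positivity) hφ
  induction e generalizing m N a J C with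
  | zero => exact ⟨N, a, J, C, T, by simpa using hJ, by simpa using hC⟩
  | succ e ih =>
    -- With g = (r+1)^e k, the hypothesis supplies (r+1)g targets, and one step needs only rg + 1.
    obtain ⟨N', a', J', C', T', hJ', hC'⟩ := T.exists_succ hE hδ hm hδm hml
      (κ := φ * (r + 2) ^ (e + 1))
      (by
        have h1 : (1 : ℝ) ≤ (r + 2) ^ e := one_le_pow₀ (by
          have : (0 : ℝ) ≤ r := by positivity
          linarith)
        calc 4 * ((r : ℝ) + 1) * (r + 2) * ε = 4 * (r + 1) * ε * (r + 2) * 1 := by ring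
          _ ≤ φ * (r + 2) * (r + 2) ^ e := by gcongr
          _ = _ := by ring) ((r + 1) ^ e * k)
      (by
        have : 1 ≤ (r + 1) ^ e * k := Nat.mul_pos (by positivity) hk
        have h2 : (r + 1) ^ (e + 1) * k = r * ((r + 1) ^ e * k) + (r + 1) ^ e * k := by ring
        omega) hC
    obtain ⟨N'', a'', J'', C'', T'', h1, h2⟩ := ih T' hJ' (fun j hj => by
      have := hC' j hj
      have h3 : φ * ((r : ℝ) + 2) ^ (e + 1) / (r + 2) = φ * (r + 2) ^ e := by
        field_simp
        ring
      rwa [h3] at this)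
    exact ⟨N'', a'', J'', C'', by rwa [add_assoc, add_comm 1 e] at T'', h1, h2⟩

/-! ### Grading the targets -/

/-- From sets covered by `U` one can choose large parts that `U` grades. -/
theorem Expands.exists_grading (hE : Expands G A ε δ) {p : ℤ} (hp : p ∈ A.index) {U : Finset V}
    (hU : U ⊆ A.block p) {θ : ℝ} (hθ : 0 < θ) (hε : 0 ≤ ε) (k : ℕ) (J : Finset ℤ)
    (hJ : k ≤ J.card) (C : ℤ → Finset V)
    (hC : ∀ j ∈ J, j ∈ A.index ∧ j ≠ p ∧ C j ⊆ A.block j ∧ Covers G U (C j) ∧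
      k * (θ + ε) * (A.block j).card ≤ (C j).card) :
    ∃ (s : ℕ → ℤ) (D Y : ℕ → Finset V), (∀ i < k, s i ∈ J) ∧
      (∀ i < k, ∀ j < k, s i = s j → i = j) ∧
      (∀ i < k, D i ⊆ C (s i) ∧ θ * (A.block (s i)).card ≤ (D i).card) ∧
      ∀ i < k, Y i ⊆ U ∧ (∀ j < k, i ≤ j → Covers G (Y i) (D j)) ∧
        ∀ j < i, Anticomplete G (Y i) (D j) := by
  induction k generalizing J C with
  | zero => exact ⟨fun _ => 0, fun _ => ∅, fun _ => ∅, by simp, by simp, by simp, by simp⟩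
  | succ k ih =>
    have hsize : ∀ j ∈ J, θ * ((A.block j).card : ℝ) ≤ (C j).card := by
      intro j hj
      obtain ⟨hjA, _, _, _, hc⟩ := hC j hj
      refine le_trans ?_ hc
      have h1 : θ ≤ ((k + 1 : ℕ) : ℝ) * (θ + ε) := by
        push_cast
        nlinarith [(by positivity : (0 : ℝ) ≤ (k : ℝ) * (θ + ε))]
      exact mul_le_mul_of_nonneg_right h1 (by positivity)
    -- `P` is minimal for covering a proportion θ of some target, so it covers less than θ + ε of
    -- every one. The target `x` receives the last index, and the others are chosen inside what `P`
    -- misses.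
    obtain ⟨P, hPU, ⟨x, hxJ, hPx⟩, u, hu, hPu⟩ := exists_minimal_subset (X := U)
      (fun P => ∃ i ∈ J, θ * ((A.block i).card : ℝ) ≤ (hit G P (C i)).card)
      (by
        obtain ⟨j, hj⟩ : J.Nonempty := Finset.card_pos.1 (by omega)
        exact ⟨j, hj, by rw [hit_eq_of_covers (hC j hj).2.2.2.1]; exact hsize j hj⟩)
      (by
        rintro ⟨j, hj, h1⟩
        rw [hit_empty] at h1
        simp only [Finset.card_empty, Nat.cast_zero] at h1
        have := mul_pos hθ (A.card_block_pos (hC j hj).1)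
        linarith)
    push Not at hPu
    obtain ⟨s, D, Y, h1, h2, h3, h4⟩ := ih (J.erase x)
      (by rw [Finset.card_erase_of_mem hxJ]; omega) (fun j => C j \ hit G P (C j)) (by
        intro j hj
        have hjJ := Finset.mem_of_mem_erase hj
        obtain ⟨hjA, hjp, hjC, hcov, hc⟩ := hC j hjJ
        refine ⟨hjA, hjp, Finset.sdiff_subset.trans hjC, hcov.mono Finset.sdiff_subset, ?_⟩
        have k1 := card_hit_le_erase hE hp hjA (Ne.symm hjp) hu (hU (hPU hu)) hjC
        have k2 := hPu j hjJ
        have k3 := card_hit_add_card_sdiff (G := G) P (C j)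
        have k4 : ((k + 1 : ℕ) : ℝ) * (θ + ε) * (A.block j).card =
          k * (θ + ε) * (A.block j).card + θ * (A.block j).card + ε * (A.block j).card := by
            push_cast; ring
        linarith)
    -- Adding `P` to the earlier sets `Y i` makes them cover the new last target and creates no edge
    -- to the earlier ones.
    refine ⟨fun i => if i = k then x else s i, fun i => if i = k then hit G P (C x) else D i,
      fun i => if i = k then P else Y i ∪ P, ?_, ?_, ?_, ?_⟩
    · intro i hi
      by_cases hik : i = k
      · simp [hik, hxJ]
      · simp only [hik, if_false]
        exact Finset.mem_of_mem_erase (h1 i (by omega))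
    · intro i hi j hj hij
      by_cases hik : i = k <;> by_cases hjk : j = k
      · omega
      · simp only [hik, hjk, if_true, if_false] at hij
        exact absurd hij.symm (Finset.ne_of_mem_erase (h1 j (by omega)))
      · simp only [hik, hjk, if_true, if_false] at hij
        exact absurd hij (Finset.ne_of_mem_erase (h1 i (by omega)))
      · simp only [hik, hjk, if_false] at hij
        exact h2 i (by omega) j (by omega) hij
    · intro i hi
      by_cases hik : i = k
      · simp only [hik, if_true]
        exact ⟨hit_subset _ _, hPx⟩
      · simp only [hik, if_false]
        obtain ⟨k1, k2⟩ := h3 i (by omega)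
        exact ⟨k1.trans Finset.sdiff_subset, k2⟩
    · have hPD : ∀ j < k, Anticomplete G P (D j) := fun j hj =>
        (anticomplete_sdiff_hit P (C (s j))).mono subset_rfl (h3 j hj).1
      intro i hi
      by_cases hik : i = k
      · simp only [hik, if_true]
        refine ⟨hPU, fun j hj hkj => ?_, fun j hj => ?_⟩
        · rw [if_pos (by omega)]
          exact covers_hit _ _
        · rw [if_neg (by omega)]
          exact hPD j hj
      · simp only [hik, if_false]
        obtain ⟨k1, k2, k3⟩ := h4 i (by omega)
        refine ⟨Finset.union_subset k1 hPU, fun j hj hij => ?_, fun j hj => ?_⟩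
        · by_cases hjk : j = k
          · rw [if_pos hjk]
            intro v hv
            obtain ⟨w, hw, hadj⟩ := covers_hit P (C x) v hv
            exact ⟨w, Finset.mem_union_right _ hw, hadj⟩
          · rw [if_neg hjk]
            intro v hv
            obtain ⟨w, hw, hadj⟩ := k2 j (by omega) hij v hv
            exact ⟨w, Finset.mem_union_left _ hw, hadj⟩
        · rw [if_neg (by omega)]
          intro v hv w hw hadj
          rcases Finset.mem_union.1 hv with hv | hv
          · exact k3 j hj v hv w hw hadj
          · exact hPD j (by omega) v hv w hw hadj

end

/-! ### From a two-sided levelling to a rainbow bi-levelling -/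

section
open scoped Classical

variable {V : Type*} {G : SimpleGraph V} {A : Blockade V} {ε δ : ℝ}

theorem Covers.nonempty {P S : Finset V} (h : Covers G P S) (hS : S.Nonempty) : P.Nonempty := by
  obtain ⟨v, hv⟩ := hS
  obtain ⟨p, hp, _⟩ := h v hv
  exact ⟨p, hp⟩

theorem IsLevelling.update {h : ℕ} {L : ℕ → Finset V} (hL : IsLevelling G h L) {C : Finset V}
    (hdisj : ∀ i ≤ h, Disjoint (L i) C) (hcov : Covers G (L h) C)
    (hanti : ∀ i < h, Anticomplete G (L i) C) :
    IsLevelling G (h + 1) (Function.update L (h + 1) C) := by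
  have hne : ∀ i ≤ h, Function.update L (h + 1) C i = L i := fun i hi =>
    Function.update_of_ne (by omega) _ _
  refine ⟨by omega, ?_, ?_, ?_, ?_⟩
  · intro i hi j hj hij
    rcases Nat.lt_or_ge h i with h1 | h1
    · obtain rfl : i = h + 1 := by omega
      rw [Function.update_self, hne j (by omega)]
      exact (hdisj j (by omega)).symm
    · rw [hne i h1]
      rcases Nat.lt_or_ge h j with h2 | h2
      · obtain rfl : j = h + 1 := by omega
        rw [Function.update_self]
        exact hdisj i h1
      · rw [hne j h2]
        exact hL.disjoint i h1 j h2 hij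
  · rw [hne 0 (by omega)]
    exact hL.card_zero
  · intro i hi
    rw [hne i (by omega)]
    rcases Nat.lt_or_ge i h with h1 | h1
    · rw [hne (i + 1) (by omega)]
      exact hL.covers i h1
    · obtain rfl : i = h := by omega
      rw [Function.update_self]
      exact hcov
  · intro i j hij hj
    rw [hne i (by omega)]
    rcases Nat.lt_or_ge h j with h1 | h1
    · obtain rfl : j = h + 1 := by omega
      rw [Function.update_self]
      exact hanti i (by omega)
    · rw [hne j h1]
      exact hL.anticomplete i j hij h1

theorem Blockade.disjoint_of_subset {i j : ℤ} (hi : i ∈ A.index) (hj : j ∈ A.index) (hij : i ≠ j)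
    {X Y : Finset V} (hX : X ⊆ A.block i) (hY : Y ⊆ A.block j) : Disjoint X Y :=
  Finset.disjoint_of_subset_left hX (Finset.disjoint_of_subset_right hY (A.disjoint i hi j hj hij))

theorem Blockade.eq_of_subset_block {i j : ℤ} (hi : i ∈ A.index) (hj : j ∈ A.index)
    {X : Finset V} (hX : X.Nonempty) (hXi : X ⊆ A.block i) (hXj : X ⊆ A.block j) : i = j := by
  by_contra hij
  obtain ⟨v, hv⟩ := hX
  exact Finset.disjoint_left.1 (A.disjoint i hi j hj hij) (hXi hv) (hXj hv)

section TwoSided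

variable {h m : ℕ} {N : ℤ → Finset V} {a : ℤ → ℤ} {J : Finset ℤ} {C : ℤ → Finset V}

theorem TwoSided.disjoint (T : TwoSided G A h m N a J C) {i j : ℤ} (hi : -h ≤ i) (hi' : i ≤ m)
    (hj : -h ≤ j) (hj' : j ≤ m) (hij : i ≠ j) : Disjoint (N i) (N j) := by
  obtain ⟨h1, h2, _⟩ := T.subset_block i hi hi'
  obtain ⟨h3, h4, _⟩ := T.subset_block j hj hj'
  exact Blockade.disjoint_of_subset h1 h3 (fun e => hij (T.injOn i j hi hi' hj hj' e)) h2 h4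

theorem TwoSided.isLevelling_left (T : TwoSided G A h m N a J C) :
    IsLevelling G h fun i => N (-i) := by
  have := T.left_pos
  refine ⟨T.left_pos, ?_, by simpa using T.card_zero, ?_, ?_⟩
  · intro i hi j hj hij
    exact T.disjoint (by omega) (by omega) (by omega) (by omega) (by omega)
  · intro i hi
    have := T.covers_left (-i) (by omega) (by omega)
    rwa [show (-(i : ℤ) - 1) = -((i + 1 : ℕ) : ℤ) by push_cast; ring] at this
  · intro i j hij hj
    exact (T.anticomplete (-j) (-i) (by omega) (by omega) (by omega)).symm

theorem TwoSided.isLevelling_right (T : TwoSided G A h m N a J C) :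
    IsLevelling G m fun i => N i := by
  refine ⟨T.right_pos, ?_, by simpa using T.card_zero, ?_, ?_⟩
  · intro i hi j hj hij
    exact T.disjoint (by omega) (by omega) (by omega) (by omega) (by omega)
  · intro i hi
    have := T.covers_right i (by omega) (by omega)
    exact_mod_cast this
  · intro i j hij hj
    exact T.anticomplete i j (by omega) (by omega) (by omega)

/-- Nonemptiness passes from a target back along the covering relations to every level. It is needed
for rainbowness, since an empty level would lie in every block. -/
theorem TwoSided.nonempty (T : TwoSided G A h m N a J C) {j : ℤ} (hj : j ∈ J)
    (hC : (C j).Nonempty) (i : ℤ) (hi : -h ≤ i) (hi' : i ≤ m) : (N i).Nonempty := by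
  rcases le_total i 0 with h0 | h0
  · have key : ∀ t : ℕ, t ≤ h → (N (-h + t)).Nonempty := by
      intro t
      induction t with
      | zero => intro _; simpa using (T.covers_first j hj).nonempty hC
      | succ t ih =>
        intro ht
        have h1 := T.covers_left (-h + (t + 1 : ℕ)) (by omega) (by omega)
        rw [show (-(h : ℤ) + (t + 1 : ℕ) - 1) = -h + t by push_cast; ring] at h1
        exact h1.nonempty (ih (by omega))
    have := key (i + h).toNat (by omega)
    rwa [show (-(h : ℤ) + (i + h).toNat) = i by omega] at this
  · have key : ∀ t : ℕ, t ≤ m → (N (m - t)).Nonempty := by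
      intro t
      induction t with
      | zero => intro _; simpa using (T.covers_last j hj).nonempty hC
      | succ t ih =>
        intro ht
        have h1 := T.covers_right (m - (t + 1 : ℕ)) (by omega) (by omega)
        rw [show ((m : ℤ) - (t + 1 : ℕ) + 1) = m - t by push_cast; ring] at h1
        exact h1.nonempty (ih (by omega))
    have := key (m - i).toNat (by omega)
    rwa [show ((m : ℤ) - (m - i).toNat) = i by omega] at this

/-- The first end grades k parts of the targets, and the sequence is then cut at its apex.
Proportion k(f + ε) is the total cost of extracting k graded parts of proportion f. -/
theorem TwoSided.exists_biLevelling (T : TwoSided G A h m N a J C) (hE : Expands G A ε δ)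
    (hε : 0 ≤ ε) {f : ℝ} (hf : 0 < f) {k : ℕ} (hk : 1 ≤ k) (hJ : k ≤ J.card)
    (hC : ∀ j ∈ J, k * (f + ε) * (A.block j).card ≤ (C j).card) :
    ∃ S : BiLevelling G, S.Rainbow A ∧ S.length = k ∧ S.height = h + m ∧ A.SizeAtLeast S.C f := by
  have hh := T.left_pos
  have hm := T.right_pos
  obtain ⟨hp, hpN, hpJ⟩ := T.subset_block (-h) le_rfl (by omega)
  obtain ⟨s, D, Y, hs, hsinj, hD, hY⟩ := hE.exists_grading hp hpN hf hε k J hJ C fun j hj =>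
    ⟨(T.target_subset j hj).1, fun e => hpJ (e ▸ hj), (T.target_subset j hj).2,
      T.covers_first j hj, hC j hj⟩
  have hsA : ∀ i < k, s i ∈ A.index := fun i hi => (T.target_subset _ (hs i hi)).1
  have hDA : ∀ i < k, D i ⊆ A.block (s i) := fun i hi =>
    (hD i hi).1.trans (T.target_subset _ (hs i hi)).2
  have hDne : ∀ i < k, (D i).Nonempty := by
    intro i hi
    have h1 := lt_of_lt_of_le (mul_pos hf (A.card_block_pos (hsA i hi))) (hD i hi).2
    exact Finset.card_pos.1 (by exact_mod_cast h1)
  set I : Finset ℤ := (Finset.range k).map Nat.castEmbedding with hI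
  have hmemI : ∀ z, z ∈ I ↔ ∃ i < k, (i : ℤ) = z := by
    intro z
    simp [hI]
  set E : Blockade V :=
    { index := I
      block := fun z => D z.toNat
      nonempty := by
        intro z hz
        obtain ⟨i, hi, rfl⟩ := (hmemI z).1 hz
        simpa using hDne i hi
      disjoint := by
        intro z hz z' hz' hne
        obtain ⟨i, hi, rfl⟩ := (hmemI z).1 hz
        obtain ⟨j, hj, rfl⟩ := (hmemI z').1 hz'
        simp only [Int.toNat_natCast]
        exact Blockade.disjoint_of_subset (hsA i hi) (hsA j hj)
          (fun e => hne (by rw [hsinj i hi j hj e])) (hDA i hi) (hDA j hj) } with hEdef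
  have hEv : ∀ v, v ∈ E.vertices ↔ ∃ i < k, v ∈ D i := by
    intro v
    simp only [Blockade.vertices, hEdef, Finset.mem_biUnion]
    constructor
    · rintro ⟨z, hz, hv⟩
      obtain ⟨i, hi, rfl⟩ := (hmemI z).1 hz
      exact ⟨i, hi, by simpa using hv⟩
    · rintro ⟨i, hi, hv⟩
      exact ⟨i, (hmemI _).2 ⟨i, hi, rfl⟩, by simpa using hv⟩
  have hcov : ∀ P : Finset V, (∀ j ∈ J, Covers G P (C j)) → Covers G P E.vertices := by
    intro P hP v hv
    obtain ⟨i, hi, hv⟩ := (hEv v).1 hv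
    exact hP _ (hs i hi) v ((hD i hi).1 hv)
  have hanti : ∀ P : Finset V, (∀ j ∈ J, Anticomplete G P (C j)) →
      Anticomplete G P E.vertices := by
    intro P hP u hu v hv
    obtain ⟨i, hi, hv⟩ := (hEv v).1 hv
    exact hP _ (hs i hi) u hu v ((hD i hi).1 hv)
  have hdisj : ∀ i : ℤ, -h ≤ i → i ≤ m → Disjoint (N i) E.vertices := by
    intro i h1 h2
    rw [Finset.disjoint_left]
    intro v hv hv'
    obtain ⟨j, hj, hv'⟩ := (hEv v).1 hv'
    obtain ⟨k1, k2, k3⟩ := T.subset_block i h1 h2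
    exact Finset.disjoint_left.1 (Blockade.disjoint_of_subset k1 (hsA j hj)
      (fun e => k3 (e ▸ hs j hj)) k2 (hDA j hj)) hv hv'
  have hreachL := T.isLevelling_left.update (C := E.vertices)
    (fun i hi => hdisj _ (by omega) (by omega)) (hcov _ T.covers_first)
    (fun i hi => hanti _ (T.anticomplete_target _ (by omega) (by omega)))
  have hreachM := T.isLevelling_right.update (C := E.vertices)
    (fun i hi => hdisj _ (by omega) (by omega)) (hcov _ T.covers_last)
    (fun i hi => hanti _ (T.anticomplete_target _ (by omega) (by omega)))
  set S : BiLevelling G :=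
    { L := ⟨h, fun i => N (-i), T.isLevelling_left⟩
      M := ⟨m, fun i => N i, T.isLevelling_right⟩
      C := E
      parallel := by
        refine ⟨by simp, fun i hi him j hj hjh => ?_⟩
        have him : i ≤ m := him
        have hjh : j ≤ h := hjh
        exact ⟨T.disjoint (by omega) (by omega) (by omega) (by omega) (by omega),
          (T.anticomplete (-j) i (by omega) (by omega) (by omega)).symm⟩
      reaches_left := hreachL
      reaches_right := hreachM
      grades := by
        refine ⟨hreachL, fun z hz => ?_⟩
        obtain ⟨i, hi, rfl⟩ := (hmemI z).1 hz
        obtain ⟨h1, h2, h3⟩ := hY i hi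
        refine ⟨Y i, h1, fun z' hz' hle => ?_, fun z' hz' hlt => ?_⟩
        · obtain ⟨j, hj, rfl⟩ := (hmemI z').1 hz'
          simpa [hEdef] using h2 j hj (by omega)
        · obtain ⟨j, hj, rfl⟩ := (hmemI z').1 hz'
          simpa [hEdef] using h3 j (by omega) } with hS
  -- Assigning to each part its block of `A` is injective; as parts are nonempty and blocks
  -- disjoint, no part lies in a second block.
  have hpart : ∃ ix : S.Part → ℤ, Function.Injective ix ∧
      ∀ p, ix p ∈ A.index ∧ S.part p ⊆ A.block (ix p) ∧ (S.part p).Nonempty := by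
    obtain ⟨hs0, hC0⟩ : s 0 ∈ J ∧ (C (s 0)).Nonempty :=
      ⟨hs 0 (by omega), (hDne 0 (by omega)).mono (hD 0 (by omega)).1⟩
    have hN : ∀ i : ℤ, -h ≤ i → i ≤ m →
        a i ∈ A.index ∧ N i ⊆ A.block (a i) ∧ (N i).Nonempty := fun i h1 h2 =>
      ⟨(T.subset_block i h1 h2).1, (T.subset_block i h1 h2).2.1, T.nonempty hs0 hC0 i h1 h2⟩
    have hsJ : ∀ z : E.index, s (z : ℤ).toNat ∈ J := by
      rintro ⟨z, hz⟩
      obtain ⟨i, hi, rfl⟩ := (hmemI z).1 hz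
      simpa using hs i hi
    refine ⟨fun p => match p with
      | .inl z => s (z : ℤ).toNat
      | .inr (.inl i) => a (-(i : ℕ))
      | .inr (.inr i) => a ((i : ℕ) + 1), ?_, ?_⟩
    · have hLlt : ∀ i : Fin (S.L.height + 1), ((i : ℕ) : ℤ) ≤ h := fun i => by
        have : (i : ℕ) < h + 1 := i.2
        omega
      have hMlt : ∀ i : Fin S.M.height, ((i : ℕ) : ℤ) + 1 ≤ m := fun i => by
        have : (i : ℕ) < m := i.2
        omega
      rintro (⟨z, hz⟩ | i | i) (⟨z', hz'⟩ | j | j) hij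
      · obtain ⟨i, hi, rfl⟩ := (hmemI z).1 hz
        obtain ⟨j, hj, rfl⟩ := (hmemI z').1 hz'
        simp only [Int.toNat_natCast] at hij
        obtain rfl := hsinj i hi j hj hij
        rfl
      · have := hLlt j
        refine absurd ?_ (T.subset_block (-((j : ℕ) : ℤ)) (by omega) (by omega)).2.2
        rw [← show s (z : ℤ).toNat = a (-((j : ℕ) : ℤ)) from hij]
        exact hsJ ⟨z, hz⟩
      · have := hMlt j
        refine absurd ?_ (T.subset_block (((j : ℕ) : ℤ) + 1) (by omega) (by omega)).2.2
        rw [← show s (z : ℤ).toNat = a (((j : ℕ) : ℤ) + 1) from hij]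
        exact hsJ ⟨z, hz⟩
      · have := hLlt i
        refine absurd ?_ (T.subset_block (-((i : ℕ) : ℤ)) (by omega) (by omega)).2.2
        rw [show a (-((i : ℕ) : ℤ)) = s (z' : ℤ).toNat from hij]
        exact hsJ ⟨z', hz'⟩
      · have := hLlt i
        have := hLlt j
        have := T.injOn _ _ (by omega) (by omega) (by omega) (by omega) hij
        have : i = j := Fin.ext (by omega)
        rw [this]
      · have := hLlt i
        have := hMlt j
        have := T.injOn _ _ (by omega) (by omega) (by omega) (by omega) hij
        omega
      · have := hMlt i
        refine absurd ?_ (T.subset_block (((i : ℕ) : ℤ) + 1) (by omega) (by omega)).2.2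
        rw [show a (((i : ℕ) : ℤ) + 1) = s (z' : ℤ).toNat from hij]
        exact hsJ ⟨z', hz'⟩
      · have := hMlt i
        have := hLlt j
        have := T.injOn _ _ (by omega) (by omega) (by omega) (by omega) hij
        omega
      · have := hMlt i
        have := hMlt j
        have := T.injOn _ _ (by omega) (by omega) (by omega) (by omega) hij
        have : i = j := Fin.ext (by omega)
        rw [this]
    · rintro (⟨z, hz⟩ | i | i)
      · obtain ⟨i, hi, rfl⟩ := (hmemI z).1 hz
        simpa [BiLevelling.part, hS, hEdef] using ⟨hsA i hi, hDA i hi, hDne i hi⟩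
      · have : (i : ℕ) < h + 1 := i.2
        exact hN _ (by omega) (by omega)
      · have : (i : ℕ) < m := i.2
        have := hN ((i : ℕ) + 1) (by omega) (by omega)
        simpa [BiLevelling.part, hS] using this
  obtain ⟨ix, hix, hp⟩ := hpart
  refine ⟨S, ⟨fun p => ⟨ix p, (hp p).1, (hp p).2.1⟩, fun i hi p q hpi hqi => ?_⟩, ?_, rfl, ?_⟩
  · apply hix
    rw [← Blockade.eq_of_subset_block hi (hp p).1 (hp p).2.2 hpi (hp p).2.1,
      ← Blockade.eq_of_subset_block hi (hp q).1 (hp q).2.2 hqi (hp q).2.1]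
  · simp [BiLevelling.length, Blockade.length, hS, hEdef, hI]
  · intro z hz
    obtain ⟨i, hi, rfl⟩ := (hmemI z).1 hz
    have hA := A.card_block_pos (hsA i hi)
    refine ⟨_, ⟨s i, hsA i hi, by simpa [hS, hEdef] using hDA i hi, rfl⟩, ?_⟩
    rw [le_div_iff₀ hA]
    simpa [hS, hEdef] using (hD i hi).2

end TwoSided

end

/-! ### Weighted counting, and levels from two families of shortest walks -/

section
open scoped Classical

/-- A weighted pigeonhole principle. -/
theorem exists_le_card_filter {α β : Type*} (S : Finset α) (T : Finset β) (hT : T.Nonempty)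
    (R : β → α → Prop) (hR : ∀ w ∈ S, ∃ τ ∈ T, R τ w) (wt : β → ℝ)
    (hwt : ∑ τ ∈ T, wt τ ≤ S.card) : ∃ τ ∈ T, wt τ ≤ (S.filter (R τ)).card := by
  by_contra hcon
  push Not at hcon
  have h1 : S ⊆ T.biUnion fun τ => S.filter (R τ) := by
    intro w hw
    obtain ⟨τ, hτ, h⟩ := hR w hw
    exact Finset.mem_biUnion.2 ⟨τ, hτ, Finset.mem_filter.2 ⟨hw, h⟩⟩
  have h2 : (S.card : ℝ) ≤ ∑ τ ∈ T, ((S.filter (R τ)).card : ℝ) := by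
    exact_mod_cast (Finset.card_le_card h1).trans Finset.card_biUnion_le
  have h3 := Finset.sum_lt_sum_of_nonempty hT hcon
  linarith

/-- Binomial expansion: each entry is either kept, at weight β, or dropped. -/
theorem sum_sublists_pow (β : ℝ) (l : List ℤ) (hl : l.Nodup) :
    ∑ t ∈ l.sublists'.toFinset, β ^ t.length = (1 + β) ^ l.length := by
  rw [List.sum_toFinset _ (List.nodup_sublists'.2 hl)]
  clear hl
  induction l with
  | nil => simp
  | cons a l ih =>
    rw [List.sublists'_cons, List.map_append, List.sum_append, ih, List.map_map]
    have : ((fun t : List ℤ => β ^ t.length) ∘ List.cons a) = fun t => β * β ^ t.length := by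
      funext t
      simp [pow_succ, mul_comm]
    rw [this, List.sum_map_mul_left, ih, List.length_cons]
    ring

theorem sum_pow_sub_le {β : ℝ} (hβ : 0 < β) {n N : ℕ} (hn : n ≤ N) :
    ∑ a ∈ Finset.range n, (1 + β) ^ (N - 1 - a) ≤ (1 + β) ^ N / β := by
  rw [le_div_iff₀ hβ]
  have key : (∑ a ∈ Finset.range n, (1 + β) ^ (N - 1 - a)) * β =
      (1 + β) ^ N - (1 + β) ^ (N - n) := by
    induction n with
    | zero => simp
    | succ n ih =>
      rw [Finset.sum_range_succ, add_mul, ih (by omega)]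
      have : N - n = N - 1 - n + 1 := by omega
      rw [this, pow_succ, show N - (n + 1) = N - 1 - n by omega]
      ring
  rw [key]
  have : 0 ≤ (1 + β) ^ (N - n) := by positivity
  linarith

theorem exists_last_of_exists {α : Type*} (Q : α → Prop) (l : List α) (h : ∃ e ∈ l, Q e) :
    ∃ s e π, l = s ++ e :: π ∧ Q e ∧ ∀ e' ∈ π, ¬ Q e' := by
  induction l with
  | nil => simp at h
  | cons a l ih =>
    by_cases hl : ∃ e ∈ l, Q e
    · obtain ⟨s, e, π, rfl, h1, h2⟩ := ih hl
      exact ⟨a :: s, e, π, rfl, h1, h2⟩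
    · push Not at hl
      obtain ⟨e, he, hQ⟩ := h
      rcases List.mem_cons.1 he with rfl | he
      · exact ⟨[], e, l, rfl, hQ, hl⟩
      · exact absurd hQ (hl e he)

variable {V : Type*} {G : SimpleGraph V} {A : Blockade V} {ε δ : ℝ}

theorem getD_mem {t : List ℤ} {a : ℕ} (ha : a < t.length) : t.getD a 0 ∈ t := by
  rw [List.getD_eq_getElem _ _ ha]
  exact List.getElem_mem ha

theorem getD_inj {t : List ℤ} (ht : t.Nodup) {a b : ℕ} (ha : a < t.length) (hb : b < t.length)
    (h : t.getD a 0 = t.getD b 0) : a = b := by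
  rw [List.getD_eq_getElem _ _ ha, List.getD_eq_getElem _ _ hb] at h
  exact (ht.getElem_inj_iff).1 h

/-- Shortest walks of two fixed types from a common apex give a two-sided levelling. -/
theorem twoSided_of_minConn {B : ℤ → Finset V} {e : ℤ} {q : V} {Λ Γ t u : List ℤ}
    {J : Finset ℤ} {C : ℤ → Finset V} (hq : q ∈ A.block e) (ht : t.Sublist Λ) (hu : u.Sublist Γ)
    (ht0 : 1 ≤ t.length) (hu0 : 1 ≤ u.length)
    (hnodup : (e :: (Λ ++ Γ)).Nodup) (hA : ∀ d ∈ e :: (Λ ++ Γ), d ∈ A.index ∧ d ∉ J)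
    (hB : ∀ d ∈ Λ ++ Γ, B d ⊆ A.block d) (hJ : ∀ j ∈ J, j ∈ A.index ∧ C j ⊆ A.block j)
    (hL : ∀ j ∈ J, ∀ w ∈ C j, MinConn G B q Λ t w) (hM : ∀ j ∈ J, ∀ w ∈ C j, MinConn G B q Γ u w)
    (hcross : ∀ d' ∈ Γ, ∀ v' ∈ B d',
      (∀ j ∈ J, ∀ w ∈ C j, ∀ t' : List ℤ, t'.Sublist Λ → ¬ Conn G B v' t' w) ∨
        ∀ d ∈ Λ, ∀ v ∈ B d, ¬ G.Adj v' v) :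
    ∃ N a, TwoSided G A t.length u.length N a J C := by
  set W := J.biUnion C with hW
  have hLW : ∀ w ∈ W, MinConn G B q Λ t w := by
    intro w hw
    obtain ⟨j, hj, hw⟩ := Finset.mem_biUnion.1 hw
    exact hL j hj w hw
  have hMW : ∀ w ∈ W, MinConn G B q Γ u w := by
    intro w hw
    obtain ⟨j, hj, hw⟩ := Finset.mem_biUnion.1 hw
    exact hM j hj w hw
  have hCW : ∀ j ∈ J, C j ⊆ W := fun j hj => Finset.subset_biUnion_of_mem C hj
  rw [List.nodup_cons] at hnodup
  obtain ⟨he, hnodup⟩ := hnodup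
  obtain ⟨hΛ, hΓ, hΛΓ⟩ := List.nodup_append.1 hnodup
  have htn := hΛ.sublist ht
  have hun := hΓ.sublist hu
  have htm : ∀ a < t.length, t.getD a 0 ∈ Λ := fun a ha => ht.subset (getD_mem ha)
  have hum : ∀ a < u.length, u.getD a 0 ∈ Γ := fun a ha => hu.subset (getD_mem ha)
  -- Negative positions follow `t`, positive ones follow `u`; both walk levels start with {q}, so
  -- the two formulas agree at 0.
  set N : ℤ → Finset V := fun i =>
    if 0 ≤ i then walkLevel G B q u W i.toNat else walkLevel G B q t W (-i).toNat with hN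
  have hNr : ∀ n : ℕ, N n = walkLevel G B q u W n := fun n => by simp [hN]
  have hNl : ∀ n : ℕ, N (-n) = walkLevel G B q t W n := by
    intro n
    rcases Nat.eq_zero_or_pos n with rfl | hn
    · simp [hN, walkLevel]
    · simp only [hN]
      rw [if_neg (by omega)]
      simp
  set a : ℤ → ℤ := fun i =>
    if i = 0 then e else if 0 < i then u.getD (i - 1).toNat 0 else t.getD (-i - 1).toNat 0 with ha
  have ha0 : a 0 = e := by simp [ha]
  have har : ∀ n : ℕ, a ((n + 1 : ℕ) : ℤ) = u.getD n 0 := by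
    intro n
    simp only [ha]
    rw [if_neg (by omega), if_pos (by omega)]
    congr 1
    omega
  have hal : ∀ n : ℕ, a (-((n + 1 : ℕ) : ℤ)) = t.getD n 0 := by
    intro n
    simp only [ha]
    rw [if_neg (by omega), if_neg (by omega)]
    congr 1
    omega
  have hcases : ∀ i : ℤ, -t.length ≤ i → i ≤ u.length → i = 0 ∨
      (∃ n < u.length, i = (n + 1 : ℕ)) ∨ ∃ n < t.length, i = -((n + 1 : ℕ) : ℤ) := by
    intro i h1 h2
    rcases lt_trichotomy i 0 with h | h | h
    · exact Or.inr (Or.inr ⟨(-i - 1).toNat, by omega, by omega⟩)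
    · exact Or.inl h
    · exact Or.inr (Or.inl ⟨(i - 1).toNat, by omega, by omega⟩)
  refine ⟨N, a, ht0, hu0, ?_, ?_, ?_, ?_, ?_, ?_, ?_, ?_, ?_, hJ⟩
  · simp [hN, walkLevel]
  · intro i h1 h2
    lift i to ℕ using h1
    have h3 : ((i : ℤ) + 1) = (i + 1 : ℕ) := by push_cast; ring
    rw [h3, hNr, hNr]
    exact covers_walkLevel (by omega)
  · intro i h1 h2
    obtain ⟨n, rfl⟩ : ∃ n : ℕ, i = -n := ⟨(-i).toNat, by omega⟩
    have h3 : (-(n : ℤ) - 1) = -((n + 1 : ℕ) : ℤ) := by push_cast; ring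
    rw [h3, hNl, hNl]
    exact covers_walkLevel (by omega)
  · intro i j h1 h2 h3
    rcases le_or_gt 0 i with hi | hi
    · lift i to ℕ using hi
      lift j to ℕ using (by omega)
      rw [hNr, hNr]
      exact anticomplete_walkLevel hMW (by omega) (by omega)
    rcases le_or_gt j 0 with hj | hj
    · obtain ⟨n, rfl⟩ : ∃ n : ℕ, i = -n := ⟨(-i).toNat, by omega⟩
      obtain ⟨n', rfl⟩ : ∃ n : ℕ, j = -n := ⟨(-j).toNat, by omega⟩
      rw [hNl, hNl]
      exact (anticomplete_walkLevel hLW (by omega) (by omega)).symm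
    · obtain ⟨n, rfl⟩ : ∃ n : ℕ, i = -((n + 1 : ℕ) : ℤ) := ⟨(-i - 1).toNat, by omega⟩
      obtain ⟨n', rfl⟩ : ∃ n : ℕ, j = (n + 1 : ℕ) := ⟨(j - 1).toNat, by omega⟩
      rw [hNl, hNr]
      intro v hv v' hv' hadj
      obtain ⟨k1, k2, w, hw, k3⟩ := mem_walkLevel_succ.1 hv
      obtain ⟨k4, _⟩ := mem_walkLevel_succ.1 hv'
      -- An edge from v' to the left vertex v could be continued along `t` to a target w, giving a
      -- walk from v' whose type is a sublist of `Λ`.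
      rcases hcross _ (hum n' (by omega)) v' k4 with h | h
      · obtain ⟨j, hj, hw⟩ := Finset.mem_biUnion.1 hw
        refine h j hj w hw (t.drop n) ((List.drop_sublist _ _).trans ht) ?_
        rw [drop_getD (by omega)]
        exact ⟨v, k1, hadj.symm, k3⟩
      · exact h _ (htm n (by omega)) v k1 hadj.symm
  · intro j hj
    rw [hNl]
    exact (covers_walkLevel_length fun w hw => (hLW w hw).conn).mono (hCW j hj)
  · intro j hj
    rw [hNr]
    exact (covers_walkLevel_length fun w hw => (hMW w hw).conn).mono (hCW j hj)
  · intro i h1 h2 j hj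
    rcases le_or_gt 0 i with hi | hi
    · lift i to ℕ using hi
      rw [hNr]
      exact (anticomplete_walkLevel_target hMW (by omega)).mono subset_rfl (hCW j hj)
    · obtain ⟨n, rfl⟩ : ∃ n : ℕ, i = -n := ⟨(-i).toNat, by omega⟩
      rw [hNl]
      exact (anticomplete_walkLevel_target hLW (by omega)).mono subset_rfl (hCW j hj)
  · intro i h1 h2
    rcases hcases i h1 h2 with rfl | ⟨n, hn, rfl⟩ | ⟨n, hn, rfl⟩
    · rw [ha0]
      refine ⟨(hA e (by simp)).1, ?_, (hA e (by simp)).2⟩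
      simpa [hN, walkLevel] using hq
    · rw [har, hNr]
      have hm : u.getD n 0 ∈ Λ ++ Γ := List.mem_append_right _ (hum n hn)
      have := hA _ (List.mem_cons_of_mem e hm)
      exact ⟨this.1, fun v hv => hB _ hm (mem_walkLevel_succ.1 hv).1, this.2⟩
    · rw [hal, hNl]
      have hm : t.getD n 0 ∈ Λ ++ Γ := List.mem_append_left _ (htm n hn)
      have := hA _ (List.mem_cons_of_mem e hm)
      exact ⟨this.1, fun v hv => hB _ hm (mem_walkLevel_succ.1 hv).1, this.2⟩
  · intro i j h1 h2 h3 h4 hij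
    have hne : ∀ d ∈ Λ ++ Γ, e ≠ d := fun d hd h => he (h ▸ hd)
    have hΛe : ∀ d ∈ Λ, e ≠ d := fun d hd => hne d (List.mem_append_left _ hd)
    have hΓe : ∀ d ∈ Γ, e ≠ d := fun d hd => hne d (List.mem_append_right _ hd)
    rcases hcases i h1 h2 with rfl | ⟨n, hn, rfl⟩ | ⟨n, hn, rfl⟩ <;>
      rcases hcases j h3 h4 with rfl | ⟨n', hn', rfl⟩ | ⟨n', hn', rfl⟩
    · rfl
    · rw [ha0, har] at hij
      exact absurd hij (hΓe _ (hum n' hn'))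
    · rw [ha0, hal] at hij
      exact absurd hij (hΛe _ (htm n' hn'))
    · rw [ha0, har] at hij
      exact absurd hij.symm (hΓe _ (hum n hn))
    · rw [har, har] at hij
      rw [getD_inj hun hn hn' hij]
    · rw [har, hal] at hij
      exact absurd hij.symm (hΛΓ _ (htm n' hn') _ (hum n hn))
    · rw [ha0, hal] at hij
      exact absurd hij.symm (hΛe _ (htm n hn))
    · rw [har, hal] at hij
      exact absurd hij (hΛΓ _ (htm n hn) _ (hum n' hn'))
    · rw [hal, hal] at hij
      rw [getD_inj htn hn hn' hij]

end

/-! ### Targets reached through vertices that avoid other blocks -/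

section
open scoped Classical

variable {V : Type*} {G : SimpleGraph V} {A : Blockade V} {ε δ : ℝ}

/-- In contrast to `Conn.mono`, membership in `B'` is asked only of vertices actually reached from
`u` by an initial part of the type. -/
theorem Conn.restrict {B B' : ℤ → Finset V} {l : List ℤ} {u w : V} (h : Conn G B u l w)
    (hB : ∀ s d s', l = s ++ d :: s' → ∀ v ∈ B d, Conn G B u s v → v ∈ B' d) :
    Conn G B' u l w := by
  induction l generalizing u with
  | nil => exact h
  | cons d l ih =>
    obtain ⟨v, hv, h1, h2⟩ := h
    refine ⟨v, hB [] d l rfl v hv h1, h1, ih h2 ?_⟩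
    intro s e s' hl x hx hc
    exact hB (d :: s) e s' (by rw [hl]; rfl) x hx ⟨v, hv, h1, hc⟩

/-- From `s`, walks of type `l` reach almost all of every block outside `l`. -/
def ReachesMost (G : SimpleGraph V) (A : Blockade V) (B : ℤ → Finset V) (ε : ℝ) (l : List ℤ)
    (i₀ : ℤ) (s : V) : Prop :=
  ∀ j ∈ A.index, j ∉ i₀ :: l → ∀ W ⊆ A.block j,
    ((W.filter fun w => ¬ Conn G B s l w).card : ℝ) < ε * (A.block j).card

theorem Expands.card_filter_not_reachesMost_lt [Fintype V] (hE : Expands G A ε δ) (hδ : 0 < δ)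
    {m : ℕ} (hm : 1 ≤ m) (hδm : δ * m ≤ ε) {B : ℤ → Finset V} {i₀ : ℤ} (hi₀ : i₀ ∈ A.index)
    {S : Finset V} (hS : S ⊆ A.block i₀) (l : List ℤ) (hl : (i₀ :: l).Nodup)
    (hlA : ∀ d ∈ l, d ∈ A.index ∧ B d ⊆ A.block d ∧ 2 * ε * (A.block d).card ≤ (B d).card)
    (hml : Fintype.card V ≤ m ^ l.length) :
    ((S.filter fun s => ¬ ReachesMost G A B ε l i₀ s).card : ℝ) < δ * (A.block i₀).card := by
  by_contra hcon
  push Not at hcon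
  obtain ⟨s, hs, h⟩ := hE.exists_conn hδ hm hδm hi₀ ((Finset.filter_subset _ _).trans hS) hcon l hl
    hlA hml
  exact (Finset.mem_filter.1 hs).2 h

/-- Choose `P` minimal such that fewer than `f` targets are less than half covered. Deleting one
vertex creates `f` such targets, so `P` itself misses half, up to ε, of each of these; at most f - 1
of the remaining targets fail to be half covered by `P`. -/
theorem Expands.exists_halves (hE : Expands G A ε δ) {X : Finset V} {D : Finset ℤ}
    (hDA : D ⊆ A.index) (hX : ∀ v ∈ X, ∃ d ∈ D, v ∈ A.block d) {J : Finset ℤ}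
    {C : ℤ → Finset V}
    (hJ : ∀ j ∈ J, j ∈ A.index ∧ j ∉ D ∧ C j ⊆ A.block j ∧ Covers G X (C j) ∧ (C j).Nonempty)
    {f : ℕ} (hf : 1 ≤ f) (hfJ : f ≤ J.card) :
    ∃ P ⊆ X, ∃ F ⊆ J, F.card = f ∧ ∃ I ⊆ J \ F, J.card + 1 ≤ I.card + 2 * f ∧
      (∀ i ∈ F, ((C i).card : ℝ) / 2 - ε * (A.block i).card ≤ (C i \ hit G P (C i)).card) ∧
      ∀ i ∈ I, ((C i).card : ℝ) / 2 ≤ (hit G P (C i)).card := by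
  obtain ⟨P, hPX, hP, u, hu, hPu⟩ := exists_minimal_subset (X := X)
    (fun P => (J.filter fun i => ((hit G P (C i)).card : ℝ) < (C i).card / 2).card < f)
    (by
      have : (J.filter fun i => ((hit G X (C i)).card : ℝ) < (C i).card / 2) = ∅ := by
        refine Finset.filter_eq_empty_iff.2 fun i hi => ?_
        rw [hit_eq_of_covers (hJ i hi).2.2.2.1]
        have : (0 : ℝ) ≤ (C i).card := by positivity
        linarith
      rw [this]
      exact hf)
    (by
      have : (J.filter fun i => ((hit G ∅ (C i)).card : ℝ) < (C i).card / 2) = J := by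
        refine Finset.filter_true_of_mem fun i hi => ?_
        rw [hit_empty]
        have : (0 : ℝ) < (C i).card := by exact_mod_cast (hJ i hi).2.2.2.2.card_pos
        simpa using this
      rw [this]
      omega)
  push Not at hPu
  obtain ⟨F, hF, hFc⟩ := Finset.exists_subset_card_eq hPu
  have hFJ : F ⊆ J := hF.trans (Finset.filter_subset _ _)
  refine ⟨P, hPX, F, hFJ, hFc,
    (J \ F).filter (fun i => ((C i).card : ℝ) / 2 ≤ (hit G P (C i)).card),
    Finset.filter_subset _ _, ?_, ?_, fun i hi => (Finset.mem_filter.1 hi).2⟩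
  · have h1 := Finset.card_filter_add_card_filter_not (s := J \ F)
      (fun i => ((C i).card : ℝ) / 2 ≤ (hit G P (C i)).card)
    have h2 := Finset.card_sdiff_add_card_eq_card hFJ
    have h3 : ((J \ F).filter fun i => ¬ ((C i).card : ℝ) / 2 ≤ (hit G P (C i)).card).card ≤
        (J.filter fun i => ((hit G P (C i)).card : ℝ) < (C i).card / 2).card := by
      refine Finset.card_le_card fun i hi => ?_
      rw [Finset.mem_filter] at hi ⊢
      exact ⟨(Finset.mem_sdiff.1 hi.1).1, not_le.1 hi.2⟩
    omega
  · intro i hi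
    obtain ⟨hiJ, hlt⟩ := Finset.mem_filter.1 (hF hi)
    obtain ⟨hiA, hiD, hiC, _, _⟩ := hJ i hiJ
    obtain ⟨d, hd, hud⟩ := hX u (hPX hu)
    have h1 := card_hit_le_erase hE (hDA hd) hiA (fun e => hiD (e ▸ hd)) hu hud hiC
    have h2 := card_hit_add_card_sdiff (G := G) P (C i)
    linarith

/-- From a vertex `q` that reaches most of the blocks through the blocks in `D`, one can reach parts
of many blocks through sets that are anticomplete to parts of some other blocks. -/
theorem Expands.exists_split_targets [Fintype V] (hE : Expands G A ε δ) (hε : 0 < ε) {r : ℕ}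
    (hr : 1 ≤ r) (hεr : 4 * ε * (1 + r * (r + 3)) ≤ 1) {D : List ℤ} (hDr : D.length = r)
    {i₀ : ℤ} (hi₀ : i₀ ∈ A.index) (hDA : ∀ d ∈ D, d ∈ A.index) {q : V} (hq : q ∈ A.block i₀)
    (hqD : ReachesMost G A A.block ε D i₀ q) {J₀ : Finset ℤ}
    (hJ₀ : ∀ j ∈ J₀, j ∈ A.index ∧ j ∉ i₀ :: D) {f g : ℕ} (hf : 1 ≤ f) (hg : 1 ≤ g)
    (hcard : r * (2 * f + g) ≤ J₀.card + r) :
    ∃ (F J : Finset ℤ) (S C B : ℤ → Finset V), F ⊆ J₀ ∧ J ⊆ J₀ ∧ Disjoint F J ∧ F.card = f ∧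
      g ≤ J.card ∧
      (∀ i ∈ F, S i ⊆ A.block i ∧ 2 * ε * (A.block i).card ≤ (S i).card) ∧
      (∀ j ∈ J, C j ⊆ A.block j ∧ (1 - 2 * ε) / (2 * r) * (A.block j).card ≤ (C j).card) ∧
      (∀ d ∈ D, B d ⊆ A.block d ∧ ∀ i ∈ F, Anticomplete G (B d) (S i)) ∧
      ∀ j ∈ J, ∀ w ∈ C j, ∃ t : List ℤ, t.Sublist D ∧ Conn G B q t w := by
  have hr' : (0 : ℝ) < r := by exact_mod_cast hr
  have hr1 : (1 : ℝ) ≤ r := by exact_mod_cast hr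
  set R : ℕ → V → Prop := fun h w => ∃ t, MinConn G A.block q D t w ∧ t.length = h with hR
  have hblock : ∀ j ∈ J₀, ∃ h ∈ Finset.Icc 1 r,
      (1 - 2 * ε) / r * ((A.block j).card : ℝ) ≤ ((A.block j).filter (R h)).card := by
    intro j hj
    obtain ⟨hjA, hjD⟩ := hJ₀ j hj
    have hA := A.card_block_pos hjA
    -- Discarding the neighbours of q forces shortest types to be nonempty, so their length lies
    -- between 1 and r.
    set W := (A.block j).filter (fun w => Conn G A.block q D w) \ hit G {q} (A.block j) with hW
    have hWc : (1 - 2 * ε) * ((A.block j).card : ℝ) ≤ W.card := by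
      have h1 := card_le_card_sdiff_add ((A.block j).filter (fun w => Conn G A.block q D w))
        (hit G {q} (A.block j))
      have h2 := hE.degree i₀ hi₀ j hjA (fun e => hjD (by simp [e])) q hq _ subset_rfl
      have h3 := hqD j hjA hjD _ subset_rfl
      have h4 := Finset.card_filter_add_card_filter_not (s := A.block j)
        (fun w => Conn G A.block q D w)
      have h5 : (((A.block j).filter (fun w => Conn G A.block q D w)).card : ℝ) +
          ((A.block j).filter (fun w => ¬ Conn G A.block q D w)).card = (A.block j).card := by
        exact_mod_cast h4
      linarith
    obtain ⟨h, hh, hc⟩ := exists_le_card_filter W (Finset.Icc 1 r) ⟨1, by simp [hr]⟩ R (by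
      intro w hw
      obtain ⟨hw1, hw2⟩ := Finset.mem_sdiff.1 hw
      obtain ⟨hwA, hwc⟩ := Finset.mem_filter.1 hw1
      obtain ⟨t, ht⟩ := exists_minConn (List.Sublist.refl D) hwc
      refine ⟨t.length, Finset.mem_Icc.2 ⟨?_, hDr ▸ ht.sublist.length_le⟩, t, ht, rfl⟩
      by_contra hlt
      have : t = [] := List.length_eq_zero_iff.1 (by omega)
      subst this
      exact hw2 (mem_hit.2 ⟨hwA, q, by simp, ht.conn⟩))
      (fun _ => (1 - 2 * ε) / r * ((A.block j).card : ℝ)) (by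
        rw [Finset.sum_const, Nat.card_Icc, nsmul_eq_mul]
        have : ((r + 1 - 1 : ℕ) : ℝ) * ((1 - 2 * ε) / r * ((A.block j).card : ℝ)) =
            (1 - 2 * ε) * (A.block j).card := by
          rw [Nat.add_sub_cancel]
          field_simp
        rw [this]
        exact hWc)
    refine ⟨h, hh, hc.trans ?_⟩
    have : W.filter (R h) ⊆ (A.block j).filter (R h) := Finset.filter_subset_filter _
      (Finset.sdiff_subset.trans (Finset.filter_subset _ _))
    exact_mod_cast Finset.card_le_card this
  obtain ⟨h, hh, hc⟩ := exists_le_card_filter J₀ (Finset.Icc 1 r) ⟨1, by simp [hr]⟩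
    (fun h j => (1 - 2 * ε) / r * ((A.block j).card : ℝ) ≤ ((A.block j).filter (R h)).card) hblock
    -- The 1 is subtracted in the reals, one unit for each of the r lengths; this is the r added to
    -- |J₀| in `hcard`.
    (fun _ => (2 * f + g : ℕ) - 1) (by
      rw [Finset.sum_const, Nat.card_Icc, nsmul_eq_mul, Nat.add_sub_cancel]
      have : ((r * (2 * f + g) : ℕ) : ℝ) ≤ (J₀.card + r : ℕ) := by exact_mod_cast hcard
      push_cast at this ⊢
      linarith)
  set J₁ := J₀.filter fun j =>
    (1 - 2 * ε) / r * ((A.block j).card : ℝ) ≤ ((A.block j).filter (R h)).card with hJ₁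
  have hJ₁c : 2 * f + g ≤ J₁.card + 1 := by
    have : ((2 * f + g : ℕ) : ℝ) ≤ (J₁.card + 1 : ℕ) := by push_cast at hc ⊢; linarith
    exact_mod_cast this
  obtain ⟨hh1, hhr⟩ := Finset.mem_Icc.1 hh
  set C₁ : ℤ → Finset V := fun j => (A.block j).filter (R h) with hC₁
  have hC₁c : ∀ j ∈ J₁, (1 - 2 * ε) / r * ((A.block j).card : ℝ) ≤ (C₁ j).card := fun j hj =>
    (Finset.mem_filter.1 hj).2
  have hmain : 3 * ε ≤ (1 - 2 * ε) / (2 * r) := by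
    rw [le_div_iff₀ (by positivity)]
    nlinarith [mul_pos hε hr', mul_pos (mul_pos hε hr') hr']
  have hhalf : ∀ j, (1 - 2 * ε) / r * ((A.block j).card : ℝ) / 2 =
      (1 - 2 * ε) / (2 * r) * (A.block j).card := fun j => by field_simp
  -- Candidates for the last interior vertex of a walk with exactly `h` interior vertices.
  set X : Finset V := Finset.univ.filter fun v => ∃ d, v ∈ A.block d ∧
    ∃ t : List ℤ, (t ++ [d]).Sublist D ∧ t.length + 1 = h ∧ Conn G A.block q t v with hX
  obtain ⟨P, hPX, F, hFJ, hFc, I, hIJ, hIc, hFcard, hIcard⟩ := hE.exists_halves (X := X)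
    (D := D.toFinset) (fun d hd => hDA d (List.mem_toFinset.1 hd)) (by
      intro v hv
      obtain ⟨_, d, hd, t, ht, _⟩ := Finset.mem_filter.1 hv
      exact ⟨d, List.mem_toFinset.2 (ht.subset (by simp)), hd⟩) (J := J₁) (C := C₁) (by
      intro j hj
      obtain ⟨hjA, hjD⟩ := hJ₀ j (Finset.mem_filter.1 hj).1
      refine ⟨hjA, fun e => hjD (by simp [List.mem_toFinset.1 e]), Finset.filter_subset _ _, ?_, ?_⟩
      · intro w hw
        obtain ⟨_, t, ht, hth⟩ := Finset.mem_filter.1 hw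
        have hne : t ≠ [] := by
          rintro rfl
          simp at hth
          omega
        have hc := ht.conn
        rw [← List.dropLast_append_getLast hne, conn_append] at hc
        obtain ⟨v, hv, h1, h2⟩ := hc
        refine ⟨v, Finset.mem_filter.2 ⟨Finset.mem_univ _, t.getLast hne, hv, t.dropLast, ?_, ?_,
          h1⟩, h2⟩
        · rw [List.dropLast_append_getLast]
          exact ht.sublist
        · rw [List.length_dropLast]
          omega
      · have h1 := hC₁c j hj
        have h2 := A.card_block_pos hjA
        have h3 : 0 < (1 - 2 * ε) / r * ((A.block j).card : ℝ) := by
          have := hhalf j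
          nlinarith [mul_pos hε h2, mul_le_mul_of_nonneg_right hmain h2.le]
        exact Finset.card_pos.1 (by exact_mod_cast lt_of_lt_of_le h3 h1)) hf (by omega)
  have hJ₁J : J₁ ⊆ J₀ := Finset.filter_subset _ _
  have hIJ₁ : I ⊆ J₁ := hIJ.trans Finset.sdiff_subset
  -- The sets S i are what `P` misses in the blocks of `F`, the targets are what `P` covers in the
  -- blocks of `I`, and B d is all of block d that is anticomplete to every S i. It remains to see
  -- that walks to the targets can stay in the sets B d.
  refine ⟨F, I, fun i => C₁ i \ hit G P (C₁ i), fun j => hit G P (C₁ j),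
    fun d => (A.block d).filter fun v => ∀ i ∈ F, ∀ w ∈ C₁ i \ hit G P (C₁ i), ¬ G.Adj v w,
    hFJ.trans hJ₁J, hIJ₁.trans hJ₁J, ?_, hFc, by omega, ?_, ?_, ?_, ?_⟩
  · rw [Finset.disjoint_left]
    intro i hi hi'
    exact (Finset.mem_sdiff.1 (hIJ hi')).2 hi
  · intro i hi
    refine ⟨Finset.sdiff_subset.trans (Finset.filter_subset _ _), ?_⟩
    have h1 := hFcard i hi
    have h2 := hC₁c i (hFJ hi)
    have h3 := A.card_block_pos (hJ₀ i (hJ₁J (hFJ hi))).1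
    have h4 := hhalf i
    have h5 := mul_le_mul_of_nonneg_right hmain h3.le
    linarith
  · intro j hj
    refine ⟨(hit_subset _ _).trans (Finset.filter_subset _ _), ?_⟩
    have h1 := hIcard j hj
    have h2 := hC₁c j (hIJ₁ hj)
    have h4 := hhalf j
    linarith
  · intro d hd
    refine ⟨Finset.filter_subset _ _, fun i hi v hv w hw => (Finset.mem_filter.1 hv).2 i hi w hw⟩
  · intro j hj w hw
    obtain ⟨_, x, hx, hxw⟩ := mem_hit.1 hw
    obtain ⟨_, d, hxd, t, ht, hth, hc⟩ := Finset.mem_filter.1 (hPX hx)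
    refine ⟨t ++ [d], ht, conn_append.2 ⟨x, ?_, ?_, hxw⟩⟩
    · refine Finset.mem_filter.2 ⟨hxd, fun i hi w' hw' => ?_⟩
      exact anticomplete_sdiff_hit P (C₁ i) x hx w' hw'
    -- The last interior vertex is in `P`, so it misses S i. An earlier vertex adjacent to S i would
    -- reach that set by a type shorter than `h`, whereas `h` is the minimum length there.
    · refine hc.restrict fun s e s' hs v hv hcv => ?_
      refine Finset.mem_filter.2 ⟨hv, fun i hi w' hw' hadj => ?_⟩
      obtain ⟨_, t', ht', hth'⟩ := Finset.mem_filter.1 (Finset.mem_sdiff.1 hw').1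
      have hsub : (s ++ [e]).Sublist D := by
        refine List.Sublist.trans ?_ ((List.sublist_append_left t [d]).trans ht)
        rw [hs, List.append_cons s e s']
        exact List.sublist_append_left _ _
      have := ht'.le_length _ hsub (conn_append.2 ⟨v, hv, hcv, hadj⟩)
      have hlen : t.length = s.length + (s'.length + 1) := by rw [hs]; simp
      simp only [List.length_append, List.length_singleton] at this
      omega

end

/-! ### Types of pairs of walks -/

section
open scoped Classical

variable {V : Type*} {G : SimpleGraph V} {A : Blockade V} {ε δ : ℝ}

theorem Expands.card_hit_path_le (hE : Expands G A ε δ) {pv : ℤ → V} {l : List ℤ}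
    (hl : ∀ e ∈ l, e ∈ A.index ∧ pv e ∈ A.block e) {j : ℤ} (hj : j ∈ A.index) (hjl : j ∉ l)
    {W : Finset V} (hW : W ⊆ A.block j) :
    ((hit G (l.map pv).toFinset W).card : ℝ) ≤ l.length * ε * (A.block j).card := by
  induction l with
  | nil => simp [hit_empty]
  | cons e l ih =>
    have h1 := ih (fun e he => hl e (by simp [he])) (fun h => hjl (by simp [h]))
    obtain ⟨heA, hpe⟩ := hl e (by simp)
    have h2 := hE.degree e heA j hj (fun h => hjl (by simp [h])) (pv e) hpe W hW
    have h3 : hit G ((e :: l).map pv).toFinset W =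
        hit G {pv e} W ∪ hit G (l.map pv).toFinset W := by
      rw [← hit_union, List.map_cons, List.toFinset_cons, Finset.insert_eq]
    have h4 : ((hit G ((e :: l).map pv).toFinset W).card : ℝ) ≤
        (hit G {pv e} W).card + (hit G (l.map pv).toFinset W).card := by
      rw [h3]
      exact_mod_cast Finset.card_union_le _ _
    rw [List.length_cons]
    push_cast
    linarith

/-- The types of pairs of walks: the position `a` of the apex on the path `Q`, the type of the walk
through `D`, and the type of the walk through the rest of `Q` and `F`. -/
noncomputable def walkTypes (Q D F : List ℤ) : Finset (Σ _ : ℕ, List ℤ × List ℤ) :=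
  (Finset.range Q.length).sigma fun a =>
    D.sublists'.toFinset ×ˢ (Q.drop (a + 1) ++ F).sublists'.toFinset

theorem mem_walkTypes {Q D F : List ℤ} {τ : Σ _ : ℕ, List ℤ × List ℤ} :
    τ ∈ walkTypes Q D F ↔ τ.1 < Q.length ∧ τ.2.1.Sublist D ∧
      τ.2.2.Sublist (Q.drop (τ.1 + 1) ++ F) := by
  simp [walkTypes]

/-- For fixed `a` the sums over the two types factor into powers of 1 + β. Each unit of `a` lowers
the total exponent by one, leaving a geometric sum. -/
theorem sum_walkTypes_le {Q D F : List ℤ} (hD : D.Nodup) (hQF : (Q ++ F).Nodup) {β c : ℝ}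
    (hβ : 0 < β) (hc : 0 ≤ c) :
    ∑ τ ∈ walkTypes Q D F, c * β ^ (τ.2.1.length + τ.2.2.length) ≤
      c * ((1 + β) ^ (D.length + Q.length + F.length) / β) := by
  have h1 : ∑ τ ∈ walkTypes Q D F, c * β ^ (τ.2.1.length + τ.2.2.length) =
      c * ∑ a ∈ Finset.range Q.length, (1 + β) ^ (D.length + Q.length + F.length - 1 - a) := by
    rw [walkTypes, Finset.sum_sigma, Finset.mul_sum]
    refine Finset.sum_congr rfl fun a ha => ?_
    have ha := Finset.mem_range.1 ha
    rw [← Finset.mul_sum]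
    congr 1
    simp only [pow_add]
    simp only [Finset.sum_product]
    rw [← Finset.sum_mul_sum, sum_sublists_pow β _ hD,
      sum_sublists_pow β _ (hQF.sublist (List.Sublist.append (List.drop_sublist _ _)
        (List.Sublist.refl _))), ← pow_add]
    congr 1
    simp only [List.length_append, List.length_drop]
    omega
  rw [h1]
  exact mul_le_mul_of_nonneg_left (sum_pow_sub_le hβ (by omega)) hc

end

/-! ### From a path to a two-sided levelling -/

section
open scoped Classical

variable {V : Type*} {G : SimpleGraph V} {A : Blockade V} {ε δ : ℝ}

set_option maxHeartbeats 1000000 in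
/-- Given a path `Q`, sets that allow walks from the path to all targets on two sides, and no edges
between the two sides, shortest walks of suitable types give a two-sided levelling. -/
theorem exists_twoSided_of_path {r ℓ k : ℕ} (hr : 1 ≤ r) (hℓ : 3 * r + 1 ≤ ℓ) (hk : 1 ≤ k)
    {φ κ : ℝ} (hφ : 0 < φ)
    (hφκ : φ * (r + 2) ^ (ℓ + 1) * (1 + 1 / ((r : ℝ) + 2)) ^ (3 * r + 2) ≤ κ)
    {B : ℤ → Finset V} {Q D F : List ℤ} {pv : ℤ → V} {J : Finset ℤ} {W : ℤ → Finset V}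
    (hQr : Q.length = r + 2) (hDr : D.length = r) (hFr : F.length = r)
    (hQF : (Q ++ F).Nodup) (hD : D.Nodup) (hDQ : ∀ d ∈ D, d ∉ Q ++ F)
    (hA : ∀ d ∈ D ++ (Q ++ F), d ∈ A.index ∧ d ∉ J ∧ B d ⊆ A.block d)
    (hpv : ∀ e ∈ Q, pv e ∈ A.block e ∧ B e = {pv e})
    (hcross : ∀ d' ∈ F, ∀ v' ∈ B d', ∀ d ∈ D, ∀ v ∈ B d, ¬ G.Adj v' v)
    (hJ : k * (r + 2) ^ (ℓ + 1) ≤ J.card)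
    (hW : ∀ j ∈ J, j ∈ A.index ∧ W j ⊆ A.block j ∧ κ * (A.block j).card ≤ (W j).card)
    (hWadj : ∀ j ∈ J, ∀ w ∈ W j, ∀ e ∈ Q, ¬ G.Adj (pv e) w)
    (hWD : ∀ j ∈ J, ∀ w ∈ W j, ∃ e ∈ Q, ∃ t : List ℤ, t.Sublist D ∧ Conn G B (pv e) t w)
    (hWF : ∀ j ∈ J, ∀ w ∈ W j, ∀ s e π, Q = s ++ e :: π → Conn G B (pv e) (π ++ F) w) :
    ∃ h m N a J C, TwoSided G A h m N a J C ∧ h + m ≤ ℓ ∧ (r + 1) ^ (ℓ - (h + m)) * k ≤ J.card ∧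
      ∀ j ∈ J, φ * (r + 2) ^ (ℓ - (h + m)) * (A.block j).card ≤ (C j).card := by
  have hr0 : (0 : ℝ) < r := by exact_mod_cast hr
  have hx : (0 : ℝ) < (r : ℝ) + 2 := by positivity
  have hρ : (0 : ℝ) < (r : ℝ) + 1 := by positivity
  set T := walkTypes Q D F with hT
  have hTne : T.Nonempty := ⟨⟨0, [], []⟩, mem_walkTypes.2 ⟨by simp; omega, by simp, by simp⟩⟩
  have hlen : ∀ τ ∈ T, τ.2.1.length + τ.2.2.length ≤ ℓ := by
    intro τ hτ
    obtain ⟨h1, h2, h3⟩ := mem_walkTypes.1 hτ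
    have h4 := h2.length_le
    have h5 := h3.length_le
    simp only [List.length_append, List.length_drop] at h5
    omega
  -- The third clause makes the apex the last vertex of the path with a walk to w through `D`; it
  -- excludes edges from later path vertices into the left levels.
  obtain ⟨R, hR⟩ : ∃ R : (Σ _ : ℕ, List ℤ × List ℤ) → V → Prop, ∀ τ w, R τ w ↔
      (MinConn G B (pv (Q.getD τ.1 0)) D τ.2.1 w ∧
      MinConn G B (pv (Q.getD τ.1 0)) (Q.drop (τ.1 + 1) ++ F) τ.2.2 w ∧
      ∀ e' ∈ Q.drop (τ.1 + 1), ∀ t' : List ℤ, t'.Sublist D → ¬ Conn G B (pv e') t' w) :=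
    ⟨_, fun _ _ => Iff.rfl⟩
  have hRW : ∀ j ∈ J, ∀ w ∈ W j, ∃ τ ∈ T, R τ w := by
    intro j hj w hw
    obtain ⟨s, e, π, hQ, ⟨t₀, ht₀, hc₀⟩, hlast⟩ := exists_last_of_exists
      (fun e => ∃ t : List ℤ, t.Sublist D ∧ Conn G B (pv e) t w) Q (hWD j hj w hw)
    obtain ⟨t, ht⟩ := exists_minConn ht₀ hc₀
    obtain ⟨u, hu⟩ := exists_minConn (List.Sublist.refl (π ++ F)) (hWF j hj w hw s e π hQ)
    have hget : Q.getD s.length 0 = e := by rw [hQ]; simp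
    have hdrop : Q.drop (s.length + 1) = π := by
      rw [hQ, List.append_cons]
      exact List.drop_left' (by simp)
    refine ⟨⟨s.length, t, u⟩, mem_walkTypes.2 ⟨?_, ht.sublist, ?_⟩,
      (hR _ _).2 ⟨?_, ?_, ?_⟩⟩
    · rw [hQ]; simp
    · simpa only [hdrop] using hu.sublist
    · simpa only [hget] using ht
    · simpa only [hget, hdrop] using hu
    · intro e' he' t' ht' hc
      simp only [hdrop] at he'
      exact hlast e' he' ⟨t', ht', hc⟩
  have hexp : D.length + Q.length + F.length = 3 * r + 2 := by omega
  have hsum : ∀ {β c : ℝ}, 0 < β → 0 ≤ c →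
      ∑ τ ∈ T, c * β ^ (τ.2.1.length + τ.2.2.length) ≤ c * ((1 + β) ^ (3 * r + 2) / β) := by
    intro β c hβ hc
    rw [← hexp]
    exact sum_walkTypes_le hD hQF hβ hc
  have hpow : ∀ {y : ℝ}, 0 < y → ∀ {n : ℕ}, n ≤ ℓ → y ^ ℓ * (1 / y) ^ n = y ^ (ℓ - n) := by
    intro y hy n hn
    rw [one_div, inv_pow, ← div_eq_mul_inv, div_eq_iff (by positivity), ← pow_add]
    congr 1
    omega
  -- With β = 1/(r+2), a type of total length n must receive the proportion φ(r+2)^(ℓ-n), exactly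
  -- what the ℓ - n lengthening steps consume.
  set wt : ℤ → (Σ _ : ℕ, List ℤ × List ℤ) → ℝ := fun j τ =>
    φ * (r + 2) ^ ℓ * (A.block j).card * (1 / ((r : ℝ) + 2)) ^ (τ.2.1.length + τ.2.2.length)
    with hwt
  have hblock : ∀ j ∈ J, ∃ τ ∈ T, wt j τ ≤ ((W j).filter (R τ)).card := by
    intro j hj
    obtain ⟨hjA, hWA, hc⟩ := hW j hj
    refine exists_le_card_filter (W j) T hTne R (hRW j hj) (wt j) ?_
    refine (hsum (by positivity) (by positivity)).trans (le_trans ?_ hc)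
    calc φ * (r + 2) ^ ℓ * ((A.block j).card : ℝ) *
          ((1 + 1 / ((r : ℝ) + 2)) ^ (3 * r + 2) / (1 / ((r : ℝ) + 2)))
        = φ * (r + 2) ^ (ℓ + 1) * (1 + 1 / ((r : ℝ) + 2)) ^ (3 * r + 2) * (A.block j).card := by
          rw [div_div_eq_mul_div, div_one]
          ring
      _ ≤ _ := mul_le_mul_of_nonneg_right hφκ (by positivity)
  -- A second pigeonhole makes the type common to many targets. Here β = 1/(r+1), matching the loss
  -- in the number of targets per lengthening step.
  obtain ⟨τ, hτ, hc⟩ := exists_le_card_filter J T hTne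
    (fun τ j => wt j τ ≤ ((W j).filter (R τ)).card) hblock
    (fun τ => (k : ℝ) * (r + 1) ^ ℓ * (1 / ((r : ℝ) + 1)) ^ (τ.2.1.length + τ.2.2.length)) (by
      refine (hsum (by positivity) (by positivity)).trans ?_
      have h1 : ((k * (r + 2) ^ (ℓ + 1) : ℕ) : ℝ) ≤ J.card := by exact_mod_cast hJ
      push_cast at h1
      refine le_trans ?_ h1
      have h2 : (1 : ℝ) ≤ 1 + 1 / (r + 1) := by
        have : 0 < 1 / ((r : ℝ) + 1) := by positivity
        linarith
      calc (k : ℝ) * (r + 1) ^ ℓ * ((1 + 1 / ((r : ℝ) + 1)) ^ (3 * r + 2) / (1 / ((r : ℝ) + 1)))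
          = k * ((r + 1) ^ (ℓ + 1) * (1 + 1 / ((r : ℝ) + 1)) ^ (3 * r + 2)) := by
            rw [div_div_eq_mul_div, div_one]
            ring
        _ ≤ k * ((r + 1) ^ (ℓ + 1) * (1 + 1 / ((r : ℝ) + 1)) ^ (ℓ + 1)) := by
            refine mul_le_mul_of_nonneg_left (mul_le_mul_of_nonneg_left ?_ (by positivity))
              (by positivity)
            exact pow_le_pow_right₀ h2 (by omega)
        _ = k * (r + 2) ^ (ℓ + 1) := by
            rw [← mul_pow]
            congr 2
            field_simp
            ring)
  obtain ⟨hτ1, hτ2, hτ3⟩ := mem_walkTypes.1 hτ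
  have hτl := hlen τ hτ
  rw [mul_assoc, hpow hρ hτl] at hc
  set J' := J.filter fun j => wt j τ ≤ ((W j).filter (R τ)).card with hJ'
  have hJ'J : J' ⊆ J := Finset.filter_subset _ _
  have hJ'c : (r + 1) ^ (ℓ - (τ.2.1.length + τ.2.2.length)) * k ≤ J'.card := by
    rw [mul_comm]
    exact_mod_cast hc
  have hCc : ∀ j ∈ J', φ * (r + 2) ^ (ℓ - (τ.2.1.length + τ.2.2.length)) *
      (A.block j).card ≤ ((W j).filter (R τ)).card := by
    intro j hj
    refine le_trans (le_of_eq ?_) (Finset.mem_filter.1 hj).2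
    rw [← hpow hx hτl]
    simp only [hwt]
    ring
  have hemem : Q.getD τ.1 0 ∈ Q := getD_mem hτ1
  have hcons : Q.getD τ.1 0 :: Q.drop (τ.1 + 1) = Q.drop τ.1 := (drop_getD hτ1).symm
  have hdropQ : ∀ d ∈ Q.drop (τ.1 + 1), d ∈ Q := fun d hd => List.mem_of_mem_drop hd
  obtain ⟨w, j₀, hj₀, hw⟩ : ∃ w, ∃ j ∈ J', w ∈ (W j).filter (R τ) := by
    have h1 : 0 < J'.card := lt_of_lt_of_le (Nat.mul_pos (by positivity) hk) hJ'c
    obtain ⟨j, hj⟩ := Finset.card_pos.1 h1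
    have h2 := A.card_block_pos (hW j (hJ'J hj)).1
    have h3 : (0 : ℝ) < ((W j).filter (R τ)).card :=
      lt_of_lt_of_le (mul_pos (mul_pos hφ (pow_pos hx _)) h2) (hCc j hj)
    obtain ⟨w, hw⟩ := Finset.card_pos.1 (Nat.cast_pos.1 h3)
    exact ⟨w, j, hj, hw⟩
  obtain ⟨hwW, hwR⟩ := Finset.mem_filter.1 hw
  obtain ⟨hwD, hwu, -⟩ := (hR _ _).1 hwR
  have hadj := hWadj j₀ (hJ'J hj₀) w hwW _ hemem
  -- An empty type would be an edge from the path to w, excluded by `hWadj`.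
  have ht1 : 1 ≤ τ.2.1.length := by
    by_contra hlt
    have h0 : τ.2.1 = [] := List.length_eq_zero_iff.1 (by omega)
    have := hwD.conn
    rw [h0] at this
    exact hadj this
  have hu1 : 1 ≤ τ.2.2.length := by
    by_contra hlt
    have h0 : τ.2.2 = [] := List.length_eq_zero_iff.1 (by omega)
    have := hwu.conn
    rw [h0] at this
    exact hadj this
  have hsubF : (Q.drop (τ.1 + 1) ++ F).Sublist (Q ++ F) :=
    List.Sublist.append (List.drop_sublist _ _) (List.Sublist.refl _)
  have hsubQ : (Q.getD τ.1 0 :: (Q.drop (τ.1 + 1) ++ F)).Sublist (Q ++ F) := by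
    rw [← List.cons_append, hcons]
    exact List.Sublist.append (List.drop_sublist _ _) (List.Sublist.refl _)
  have hallmem : ∀ d ∈ Q.getD τ.1 0 :: (D ++ (Q.drop (τ.1 + 1) ++ F)), d ∈ D ++ (Q ++ F) := by
    intro d hd
    rcases List.mem_cons.1 hd with rfl | hd
    · exact List.mem_append_right _ (List.mem_append_left _ hemem)
    · rcases List.mem_append.1 hd with hd | hd
      · exact List.mem_append_left _ hd
      · exact List.mem_append_right _ (hsubF.subset hd)
  obtain ⟨N, a, hTS⟩ := twoSided_of_minConn (G := G) (A := A) (B := B) (e := Q.getD τ.1 0)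
    (q := pv (Q.getD τ.1 0)) (Λ := D) (Γ := Q.drop (τ.1 + 1) ++ F) (t := τ.2.1) (u := τ.2.2)
    (J := J') (C := fun j => (W j).filter (R τ)) (hpv _ hemem).1 hτ2 hτ3 ht1 hu1
    (by
      have hn := hQF.sublist hsubQ
      rw [List.nodup_cons] at hn ⊢
      refine ⟨fun hmem => ?_, List.nodup_append.2 ⟨hD, hn.2, fun d hd d' hd' e => ?_⟩⟩
      · rcases List.mem_append.1 hmem with h | h
        · exact hDQ _ h (List.mem_append_left _ hemem)
        · exact hn.1 h
      · subst e
        exact hDQ d hd (hsubF.subset hd'))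
    (fun d hd => ⟨(hA d (hallmem d hd)).1, fun h => (hA d (hallmem d hd)).2.1 (hJ'J h)⟩)
    (fun d hd => (hA d (hallmem d (List.mem_cons_of_mem _ hd))).2.2)
    (fun j hj => ⟨(hW j (hJ'J hj)).1,
      (Finset.filter_subset _ _).trans (hW j (hJ'J hj)).2.1⟩)
    (fun j hj w hw => ((hR _ _).1 (Finset.mem_filter.1 hw).2).1)
    (fun j hj w hw => ((hR _ _).1 (Finset.mem_filter.1 hw).2).2.1)
    (by
      intro d' hd' v' hv'
      rcases List.mem_append.1 hd' with h | h
      · left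
        intro j hj w hw t' ht'
        rw [(hpv d' (hdropQ d' h)).2, Finset.mem_singleton] at hv'
        rw [hv']
        exact ((hR _ _).1 (Finset.mem_filter.1 hw).2).2.2 d' h t' ht'
      · exact Or.inr (hcross d' h v' hv'))
  exact ⟨_, _, N, a, J', _, hTS, hτl, hJ'c, hCc⟩

end

/-! ### Building the path -/

section
open scoped Classical

variable {V : Type*} {G : SimpleGraph V} {A : Blockade V} {ε δ : ℝ}

theorem exists_mem_and_of_card_filter_not_lt {α : Type*} {X : Finset α} {P R : α → Prop} {x y : ℝ}
    (hP : ((X.filter fun v => ¬ P v).card : ℝ) < x) (hR : ((X.filter fun v => ¬ R v).card : ℝ) < y)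
    (hX : x + y ≤ X.card) : ∃ v ∈ X, P v ∧ R v := by
  by_contra hcon
  push Not at hcon
  have h1 : X ⊆ (X.filter fun v => ¬ P v) ∪ X.filter fun v => ¬ R v := by
    intro v hv
    by_cases hPv : P v
    · exact Finset.mem_union_right _ (Finset.mem_filter.2 ⟨hv, hcon v hv hPv⟩)
    · exact Finset.mem_union_left _ (Finset.mem_filter.2 ⟨hv, hPv⟩)
  have h2 : (X.card : ℝ) ≤ (X.filter fun v => ¬ P v).card + (X.filter fun v => ¬ R v).card := by
    exact_mod_cast (Finset.card_le_card h1).trans (Finset.card_union_le _ _)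
  linarith

theorem exists_index_split (I : Finset ℤ) {r : ℕ} (hI : 2 * r + 1 ≤ I.card) :
    ∃ (i₀ : ℤ) (D E : List ℤ) (J₀ : Finset ℤ), D.length = r ∧ E.length = r ∧
      (i₀ :: (D ++ E)).Nodup ∧ (∀ d ∈ i₀ :: (D ++ E), d ∈ I) ∧
      (∀ j ∈ J₀, j ∈ I ∧ j ∉ i₀ :: (D ++ E)) ∧ J₀.card + (2 * r + 1) = I.card := by
  have hlen := I.length_toList
  have hnd := I.nodup_toList
  have hmem : ∀ d, d ∈ I.toList ↔ d ∈ I := fun d => Finset.mem_toList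
  generalize I.toList = L at hlen hnd hmem
  cases L with
  | nil => simp at hlen; omega
  | cons i₀ L =>
    rw [List.length_cons] at hlen
    have hL : L = (L.take r ++ (L.drop r).take r) ++ (L.drop r).drop r := by
      rw [List.append_assoc, List.take_append_drop, List.take_append_drop]
    have hl1 : (L.take r).length = r := by rw [List.length_take]; omega
    have hl2 : ((L.drop r).take r).length = r := by
      rw [List.length_take, List.length_drop]; omega
    generalize L.take r = D at hL hl1
    generalize (L.drop r).take r = E at hL hl2
    generalize (L.drop r).drop r = R at hL
    subst hL
    rw [← List.cons_append] at hnd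
    obtain ⟨hnd1, hnd2, hnd3⟩ := List.nodup_append.1 hnd
    refine ⟨i₀, D, E, R.toFinset, hl1, hl2, hnd1, fun d hd => (hmem d).1 ?_, fun j hj => ?_, ?_⟩
    · rw [← List.cons_append]
      exact List.mem_append_left _ hd
    · rw [List.mem_toFinset] at hj
      refine ⟨(hmem j).1 ?_, fun h => hnd3 j h j hj rfl⟩
      rw [← List.cons_append]
      exact List.mem_append_right _ hj
    · rw [List.toFinset_card_of_nodup hnd2]
      simp only [List.length_append] at hlen
      omega

/-- Singleton blocks force the walk through every vertex of the path, so it can be started at any of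
them. -/
theorem Conn.suffix_of_singletons {B : ℤ → Finset V} {pv : ℤ → V} {i₀ : ℤ} {L F : List ℤ} {w : V}
    (h : Conn G B (pv i₀) (L ++ F) w) (hB : ∀ e ∈ L, B e = {pv e}) {s π : List ℤ} {e : ℤ}
    (hs : i₀ :: L = s ++ e :: π) : Conn G B (pv e) (π ++ F) w := by
  cases s with
  | nil =>
    rw [List.nil_append, List.cons.injEq] at hs
    rw [← hs.1, ← hs.2]
    exact h
  | cons d s =>
    rw [List.cons_append, List.cons.injEq] at hs
    rw [hs.2, List.append_assoc, List.cons_append, conn_append] at h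
    obtain ⟨v, hv, -, h2⟩ := h
    rw [hB e (by rw [hs.2]; simp), Finset.mem_singleton] at hv
    rwa [← hv]

set_option maxHeartbeats 1000000 in
theorem Expands.exists_twoSided [Fintype V] (hE : Expands G A ε δ) (hε : 0 < ε) (hδ : 0 < δ)
    {m : ℕ} (hm : 1 ≤ m) (hδm : δ * m ≤ ε) {r : ℕ} (hr : 1 ≤ r) (hml : Fintype.card V ≤ m ^ r)
    (hεr : 4 * ε * (1 + r * (r + 3)) ≤ 1) {ℓ : ℕ} (hℓ : 3 * r + 1 ≤ ℓ) {k : ℕ} (hk : 1 ≤ k)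
    {φ : ℝ} (hφ : 0 < φ)
    (hφr : φ * (r + 2) ^ (ℓ + 1) * (1 + 1 / ((r : ℝ) + 2)) ^ (3 * r + 2) ≤ 1 / (4 * r))
    (hcard : r * (2 * (r + 1) + k * (r + 2) ^ (ℓ + 1)) + (2 * r + 1) ≤ A.index.card + r) :
    ∃ h m N a J C, TwoSided G A h m N a J C ∧ h + m ≤ ℓ ∧ (r + 1) ^ (ℓ - (h + m)) * k ≤ J.card ∧
      ∀ j ∈ J, φ * (r + 2) ^ (ℓ - (h + m)) * (A.block j).card ≤ (C j).card := by
  have hr1 : (1 : ℝ) ≤ r := by exact_mod_cast hr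
  have hr0 : (0 : ℝ) < r := by linarith
  have hg : 1 ≤ k * (r + 2) ^ (ℓ + 1) := Nat.mul_pos hk (by positivity)
  have hδε : δ ≤ ε := by
    have : (1 : ℝ) ≤ m := by exact_mod_cast hm
    nlinarith
  have hε1 : 2 * ε ≤ 1 := by
    have : 0 ≤ ε * (r * (r + 3)) := by positivity
    nlinarith
  have hblk : ∀ d ∈ A.index,
      d ∈ A.index ∧ A.block d ⊆ A.block d ∧ 2 * ε * (A.block d).card ≤ (A.block d).card :=
    fun d hd => ⟨hd, subset_rfl, mul_le_of_le_one_left (by positivity) hε1⟩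
  obtain ⟨i₀, D, E, J₀, hDr, hEr, hnd, hI, hJ₀, hJ₀c⟩ := exists_index_split A.index (r := r) (by
    nlinarith)
  have hi₀ : i₀ ∈ A.index := hI i₀ (by simp)
  have hDA : ∀ d ∈ D, d ∈ A.index := fun d hd => hI d (by simp [hd])
  have hEA : ∀ d ∈ E, d ∈ A.index := fun d hd => hI d (by simp [hd])
  have hnD : (i₀ :: D).Nodup := hnd.sublist ((List.sublist_append_left D E).cons_cons i₀)
  have hnE : (i₀ :: E).Nodup := hnd.sublist ((List.sublist_append_right D E).cons_cons i₀)
  -- Each of the two lists rules out less than a proportion δ of the block, and 2δ ≤ 1.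
  obtain ⟨q, hq, hqD, hqE⟩ := exists_mem_and_of_card_filter_not_lt
    (hE.card_filter_not_reachesMost_lt hδ hm hδm hi₀ subset_rfl D hnD
      (fun d hd => hblk d (hDA d hd)) (by rwa [hDr]))
    (hE.card_filter_not_reachesMost_lt hδ hm hδm hi₀ subset_rfl E hnE
      (fun d hd => hblk d (hEA d hd)) (by rwa [hEr])) (by
      have := A.card_block_pos hi₀
      nlinarith)
  -- Of the f = r + 1 blocks in `F`, one hosts the end y of the path, and r carry walks from y to
  -- the targets.
  obtain ⟨F, J, S, C, B, hFJ₀, hJJ₀, hFJ, hFc, hJc, hS, hC, hB, hconn⟩ :=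
    hE.exists_split_targets hε hr hεr hDr hi₀ hDA hq hqD (J₀ := J₀) (f := r + 1)
      (g := k * (r + 2) ^ (ℓ + 1))
      (fun j hj => ⟨(hJ₀ j hj).1, fun h => (hJ₀ j hj).2
        (((List.sublist_append_left D E).cons_cons i₀).subset h)⟩) (by omega) hg (by omega)
  obtain ⟨f₀, F', hF', hFr, hFn⟩ : ∃ f₀ F', (∀ i, i ∈ F ↔ i ∈ f₀ :: F') ∧ F'.length = r ∧
      (f₀ :: F').Nodup := by
    have h1 := F.length_toList
    have h2 := F.nodup_toList
    have h3 : ∀ i, i ∈ F ↔ i ∈ F.toList := fun i => Finset.mem_toList.symm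
    generalize F.toList = L at h1 h2 h3
    cases L with
    | nil => simp at h1; omega
    | cons f₀ F' => exact ⟨f₀, F', h3, by simp at h1; omega, h2⟩
  have hf₀ : f₀ ∈ F := (hF' f₀).2 (by simp)
  have hF'F : ∀ d ∈ F', d ∈ F := fun d hd => (hF' d).2 (by simp [hd])
  have hFA : ∀ d ∈ F, d ∈ A.index := fun d hd => (hJ₀ d (hFJ₀ hd)).1
  have hFnot : ∀ d ∈ F, d ∉ i₀ :: (D ++ E) := fun d hd => (hJ₀ d (hFJ₀ hd)).2
  have hJnot : ∀ d ∈ J, d ∉ i₀ :: (D ++ E) := fun d hd => (hJ₀ d (hJJ₀ hd)).2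
  have hFJ' : ∀ d ∈ F, d ∉ J := fun d hd hd' => Finset.disjoint_left.1 hFJ hd hd'
  -- S f₀ has proportion 2ε; less than δ ≤ ε of the block is lost for `F'`, and less than ε is
  -- unreachable from q through `E`.
  obtain ⟨y, hy, hyF, hyE⟩ := exists_mem_and_of_card_filter_not_lt
    (hE.card_filter_not_reachesMost_lt hδ hm hδm (hFA f₀ hf₀) (hS f₀ hf₀).1 F' hFn
      (fun d hd => ⟨hFA d (hF'F d hd), hS d (hF'F d hd)⟩) (by rwa [hFr]))
    (hqE f₀ (hFA f₀ hf₀) (fun h => hFnot f₀ hf₀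
        (((List.sublist_append_right D E).cons_cons i₀).subset h)) (S f₀) (hS f₀ hf₀).1) (by
      have := A.card_block_pos (hFA f₀ hf₀)
      have := (hS f₀ hf₀).2
      nlinarith)
  obtain ⟨p, hpE, hp⟩ := hyE.exists_path (List.nodup_cons.1 hnE).2
  have hi₀E : i₀ ∉ E := (List.nodup_cons.1 hnE).1
  have hi₀D : i₀ ∉ D := (List.nodup_cons.1 hnD).1
  have hDE : ∀ d ∈ D, d ∉ E := fun d hd hd' =>
    (List.nodup_append.1 (List.nodup_cons.1 hnd).2).2.2 d hd d hd' rfl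
  have hf₀i : f₀ ≠ i₀ := fun h => hFnot f₀ hf₀ (by simp [h])
  obtain ⟨pv, hpv0, hpvf, hpvE⟩ : ∃ pv : ℤ → V, pv i₀ = q ∧ pv f₀ = y ∧ ∀ d ∈ E, pv d = p d := by
    refine ⟨fun z => if z = i₀ then q else if z = f₀ then y else p z, by simp, by simp [hf₀i],
      fun d hd => ?_⟩
    have h1 : d ≠ i₀ := fun h => hi₀E (h ▸ hd)
    have h2 : d ≠ f₀ := fun h => hFnot f₀ hf₀ (by simp [← h, hd])
    simp [h1, h2]
  obtain ⟨Q, hQ⟩ : ∃ Q : List ℤ, Q = i₀ :: (E ++ [f₀]) := ⟨_, rfl⟩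
  have hmemQ : ∀ z, z ∈ Q ↔ z = i₀ ∨ z ∈ E ∨ z = f₀ := by simp [hQ]
  have hDQ : ∀ d ∈ D, d ∉ Q := by
    intro d hd h
    rcases (hmemQ d).1 h with h | h | h
    · exact hi₀D (h ▸ hd)
    · exact hDE d hd h
    · exact hFnot f₀ hf₀ (by simp [← h, hd])
  have hF'D : ∀ d ∈ F', d ∉ D := fun d hd h => hFnot d (hF'F d hd) (by simp [h])
  have hF'Q : ∀ d ∈ F', d ∉ Q := by
    intro d hd h
    rcases (hmemQ d).1 h with h | h | h
    · exact hFnot d (hF'F d hd) (by simp [h])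
    · exact hFnot d (hF'F d hd) (by simp [h])
    · exact (List.nodup_cons.1 hFn).1 (h ▸ hd)
  obtain ⟨B', hB'Q, hB'D, hB'F⟩ : ∃ B' : ℤ → Finset V, (∀ z ∈ Q, B' z = {pv z}) ∧
      (∀ z ∈ D, B' z = B z) ∧ ∀ z ∈ F', B' z = S z := by
    refine ⟨fun z => if z ∈ Q then {pv z} else if z ∈ D then B z else S z,
      fun z hz => by simp [hz], fun z hz => by simp [hz, hDQ z hz],
      fun z hz => by simp [hF'D z hz, hF'Q z hz]⟩
  have hpvQ : ∀ e ∈ Q, e ∈ A.index ∧ pv e ∈ A.block e := by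
    intro e he
    rcases (hmemQ e).1 he with rfl | h | rfl
    · exact ⟨hi₀, by rwa [hpv0]⟩
    · exact ⟨hEA e h, by rw [hpvE e h]; exact hpE e h⟩
    · exact ⟨hFA e hf₀, by rw [hpvf]; exact (hS e hf₀).1 hy⟩
  have hQJ : ∀ e ∈ Q, e ∉ J := by
    intro e he hJ
    rcases (hmemQ e).1 he with h | h | h
    · exact hJnot e hJ (by simp [h])
    · exact hJnot e hJ (by simp [h])
    · exact hFJ' f₀ hf₀ (h ▸ hJ)
  have hQr : Q.length = r + 2 := by simp [hQ, hEr]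
  have hQn : Q.Nodup := by
    rw [hQ, List.nodup_cons, List.nodup_append]
    refine ⟨by simp [hi₀E, hf₀i.symm], (List.nodup_cons.1 hnE).2, by simp, fun d hd d' hd' h => ?_⟩
    rw [List.mem_singleton] at hd'
    exact hFnot f₀ hf₀ (by simp [← hd', ← h, hd])
  obtain ⟨W, hW⟩ : ∃ W : ℤ → Finset V, ∀ j, W j =
      (C j).filter (fun w => Conn G S y F' w) \ hit G (Q.map pv).toFinset (C j) := ⟨_, fun _ => rfl⟩
  have hWC : ∀ j, W j ⊆ C j := fun j => by
    rw [hW]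
    exact Finset.sdiff_subset.trans (Finset.filter_subset _ _)
  refine exists_twoSided_of_path (B := B') (Q := Q) (D := D) (F := F') (pv := pv) (J := J) (W := W)
    hr hℓ hk hφ hφr hQr hDr hFr ?_ (List.nodup_cons.1 hnD).2 ?_ ?_
    (fun e he => ⟨(hpvQ e he).2, hB'Q e he⟩) ?_ hJc ?_ ?_ ?_ ?_
  · exact List.nodup_append.2 ⟨hQn, (List.nodup_cons.1 hFn).2,
      fun d hd d' hd' h => hF'Q d' hd' (h ▸ hd)⟩
  · intro d hd h
    rcases List.mem_append.1 h with h | h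
    · exact hDQ d hd h
    · exact hF'D d h hd
  · intro d hd
    rcases List.mem_append.1 hd with h | h
    · refine ⟨hDA d h, fun hJ => hJnot d hJ (by simp [h]), ?_⟩
      rw [hB'D d h]
      exact (hB d h).1
    · rcases List.mem_append.1 h with h | h
      · refine ⟨(hpvQ d h).1, hQJ d h, ?_⟩
        rw [hB'Q d h, Finset.singleton_subset_iff]
        exact (hpvQ d h).2
      · refine ⟨hFA d (hF'F d h), hFJ' d (hF'F d h), ?_⟩
        rw [hB'F d h]
        exact (hS d (hF'F d h)).1
  · intro d' hd' v' hv' d hd v hv hadj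
    rw [hB'F d' hd'] at hv'
    rw [hB'D d hd] at hv
    exact (hB d hd).2 d' (hF'F d' hd') v hv v' hv' hadj.symm
  · intro j hj
    have hjA := (hJ₀ j (hJJ₀ hj)).1
    refine ⟨hjA, (hWC j).trans (hC j hj).1, ?_⟩
    have h1 := hyF j hjA (fun h => hFJ' j ((hF' j).2 h) hj) (C j) (hC j hj).1
    have h2 := hE.card_hit_path_le hpvQ hjA (fun h => hQJ j h hj) (hC j hj).1
    rw [hQr] at h2
    push_cast at h2
    have h3 : C j ⊆ W j ∪ ((C j).filter (fun w => ¬ Conn G S y F' w) ∪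
        hit G (Q.map pv).toFinset (C j)) := by
      intro w hw
      by_cases hc : Conn G S y F' w <;> by_cases hh : w ∈ hit G (Q.map pv).toFinset (C j) <;>
        simp [hW, hw, hc, hh]
    have h4 : ((C j).card : ℝ) ≤ (W j).card + (((C j).filter fun w => ¬ Conn G S y F' w).card +
        (hit G (Q.map pv).toFinset (C j)).card) := by
      exact_mod_cast (Finset.card_le_card h3).trans ((Finset.card_union_le _ _).trans
        (Nat.add_le_add_left (Finset.card_union_le _ _) _))
    have h5 := (hC j hj).2
    have h6 := A.card_block_pos hjA
    -- The loss (r + 3)ε is ε for vertices not reached from y and (r + 2)ε for neighbours of the r +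
    -- 2 path vertices.
    have h7 : 1 / (4 * (r : ℝ)) ≤ (1 - 2 * ε) / (2 * r) - (r + 3) * ε := by
      rw [div_le_iff₀ (by positivity)]
      have : ((1 - 2 * ε) / (2 * r) - (r + 3) * ε) * (4 * r) =
          2 * (1 - 2 * ε) - 4 * ε * (r * (r + 3)) := by
        field_simp
        ring
      rw [this]
      linarith
    have h8 := mul_le_mul_of_nonneg_right h7 h6.le
    linarith
  · intro j hj w hw e he hadj
    rw [hW, Finset.mem_sdiff] at hw
    refine hw.2 (mem_hit.2 ⟨(Finset.mem_filter.1 hw.1).1, pv e, ?_, hadj⟩)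
    rw [List.mem_toFinset]
    exact List.mem_map_of_mem he
  · intro j hj w hw
    obtain ⟨t, ht, hc⟩ := hconn j hj w (hWC j hw)
    refine ⟨i₀, (hmemQ i₀).2 (Or.inl rfl), t, ht, ?_⟩
    rw [hpv0]
    exact hc.mono fun d hd => (hB'D d (ht.subset hd)).ge
  · intro j hj w hw s e π hs
    rw [hW, Finset.mem_sdiff] at hw
    rw [hQ] at hs
    refine Conn.suffix_of_singletons (i₀ := i₀) (L := E ++ [f₀]) ?_ (fun e he => ?_) hs
    · rw [List.append_assoc, List.singleton_append, conn_append]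
      refine ⟨y, ?_, ?_, (Finset.mem_filter.1 hw.1).2.mono fun d hd => (hB'F d hd).ge⟩
      · rw [hB'Q f₀ ((hmemQ f₀).2 (by simp)), hpvf, Finset.mem_singleton]
      · rw [hpv0]
        exact hp.mono fun d hd => by rw [hB'Q d ((hmemQ d).2 (by simp [hd])), hpvE d hd]
    · refine hB'Q e ((hmemQ e).2 ?_)
      simpa using Or.inr (a := e = i₀) (by simpa using he)

end

/-! ### Constants and conclusion -/

section
open scoped Classical

variable {V : Type*} {G : SimpleGraph V} {A : Blockade V} {ε δ : ℝ}

theorem Blockade.card_filter_adj_le (A : Blockade V) (hε : (A.linkage G : ℝ) ≤ ε) {i j : ℤ}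
    (hi : i ∈ A.index) (hj : j ∈ A.index) (hij : i ≠ j) {v : V} (hv : v ∈ A.block i) :
    (((A.block j).filter fun w => G.Adj v w).card : ℝ) ≤ ε * (A.block j).card := by
  have h1 : (maxDegreeTo G (A.block i) (A.block j) : NNReal) / ((A.block j).card : NNReal) ≤
      A.linkage G :=
    Finset.le_sup (f := fun p : ℤ × ℤ =>
      (maxDegreeTo G (A.block p.1) (A.block p.2) : NNReal) / ((A.block p.2).card : NNReal))
      (b := (i, j)) (Finset.mem_offDiag.2 ⟨hi, hj, hij⟩)
  have h2 : (maxDegreeTo G (A.block i) (A.block j) : ℝ) / ((A.block j).card : ℝ) ≤ ε :=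
    le_trans (by exact_mod_cast NNReal.coe_le_coe.2 h1) hε
  rw [div_le_iff₀ (A.card_block_pos hj)] at h2
  refine le_trans ?_ h2
  have h3 := Finset.le_sup (f := fun v => ((A.block j).filter fun w => G.Adj v w).card) hv
  exact_mod_cast h3

/-- If X has proportion δ and the part it leaves uncovered had proportion ε ≥ γ, then the uncovered
part, in the γ role, and X, in the δ role, would witness divergence. -/
theorem Blockade.expands (A : Blockade V) (hε : (A.linkage G : ℝ) ≤ ε) {γ : ℝ} (hγ : γ ≤ ε)
    (hdiv : ¬ A.Divergent G γ δ) : Expands G A ε δ where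
  degree := by
    intro i hi j hj hij v hv W hW
    refine le_trans ?_ (A.card_filter_adj_le hε hi hj hij hv)
    refine Nat.cast_le.2 (Finset.card_le_card fun w hw => ?_)
    obtain ⟨hw1, p, hp, hpw⟩ := mem_hit.1 hw
    rw [Finset.mem_singleton] at hp
    subst hp
    exact Finset.mem_filter.2 ⟨hW hw1, hpw⟩
  expand := by
    intro i hi j hj hij X hX hXc W hW
    by_contra hcon
    push Not at hcon
    refine hdiv ⟨j, hj, i, hi, hij.symm, W \ hit G X W, Finset.sdiff_subset.trans hW, X, hX,
      le_trans (mul_le_mul_of_nonneg_right hγ (Nat.cast_nonneg _)) hcon, hXc, ?_⟩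
    intro a ha b hb hab
    rw [Finset.mem_sdiff] at ha
    exact ha.2 (mem_hit.2 ⟨ha.1, b, hb, hab.symm⟩)

/-- Take m = ⌈n^c⌉, which is at most n^c + 1 ≤ 2n^c. The resulting factor 2 is absorbed by
`two_mul_inv_pow_le`. -/
theorem exists_nat_root {n : ℕ} (hn : 1 ≤ n) {c : ℝ} (hc : 0 < c) {r : ℕ} (hcr : 1 ≤ c * r) :
    ∃ m : ℕ, 1 ≤ m ∧ n ≤ m ^ r ∧ (m : ℝ) * (n : ℝ) ^ (-c) ≤ 2 := by
  have hn1 : (1 : ℝ) ≤ n := by exact_mod_cast hn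
  have hn0 : (0 : ℝ) < n := by linarith
  have h1 : (1 : ℝ) ≤ (n : ℝ) ^ c := Real.one_le_rpow hn1 hc.le
  refine ⟨⌈(n : ℝ) ^ c⌉₊, Nat.one_le_ceil_iff.2 (by linarith), ?_, ?_⟩
  · have h2 : (n : ℝ) ≤ ((n : ℝ) ^ c) ^ r := by
      rw [← Real.rpow_natCast, ← Real.rpow_mul hn0.le]
      simpa using Real.rpow_le_rpow_of_exponent_le hn1 hcr
    have h3 : ((n : ℝ) ^ c) ^ r ≤ ((⌈(n : ℝ) ^ c⌉₊ : ℕ) : ℝ) ^ r :=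
      pow_le_pow_left₀ (by linarith) (Nat.le_ceil _) _
    exact_mod_cast h2.trans h3
  · have h2 := (Nat.ceil_lt_add_one (show (0 : ℝ) ≤ (n : ℝ) ^ c by linarith)).le
    rw [Real.rpow_neg hn0.le, ← div_eq_mul_inv, div_le_iff₀ (by linarith)]
    linarith

/-- Each of 128, 2^(ℓ+2), (r+1)^3 and K is at most K, and K^4 ≤ K^K. -/
theorem two_mul_inv_pow_le {r ℓ K : ℕ} (hr : 1 ≤ r) (hℓ : 3 * r + 1 ≤ ℓ)
    (hK : (r + 2) ^ (ℓ + 2) ≤ K) :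
    2 * (K : ℝ) ^ (-(K : ℤ)) ≤ (2 : ℝ) ^ (-8 - (ℓ : ℤ)) / (((r + 1 : ℕ) : ℝ) ^ 3 * (K : ℝ)) := by
  have h1 : 3 ^ (ℓ + 2) ≤ K := (Nat.pow_le_pow_left (by omega) _).trans hK
  have h2 : 729 ≤ K := by
    refine le_trans ?_ h1
    calc 729 = 3 ^ 6 := by norm_num
      _ ≤ 3 ^ (ℓ + 2) := Nat.pow_le_pow_right (by norm_num) (by omega)
  have h3 : 2 ^ (ℓ + 2) ≤ K := (Nat.pow_le_pow_left (by norm_num) _).trans h1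
  have h4 : (r + 1) ^ 3 ≤ K := by
    refine le_trans ?_ hK
    calc (r + 1) ^ 3 ≤ (r + 2) ^ 3 := Nat.pow_le_pow_left (by omega) _
      _ ≤ (r + 2) ^ (ℓ + 2) := Nat.pow_le_pow_right (by omega) (by omega)
  have h5 : 2 ^ (ℓ + 9) * ((r + 1) ^ 3 * K) ≤ K ^ K := by
    calc 2 ^ (ℓ + 9) * ((r + 1) ^ 3 * K) = 128 * 2 ^ (ℓ + 2) * ((r + 1) ^ 3 * K) := by
          rw [pow_add, pow_add]
          ring
      _ ≤ K * K * (K * K) := by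
          gcongr
          omega
      _ = K ^ 4 := by ring
      _ ≤ K ^ K := Nat.pow_le_pow_right (by omega) (by omega)
  have hK0 : (0 : ℝ) < K := by
    have : 0 < K := by omega
    exact_mod_cast this
  have h6 : (2 : ℝ) ^ (ℓ + 9) * (((r + 1 : ℕ) : ℝ) ^ 3 * K) ≤ (K : ℝ) ^ K := by exact_mod_cast h5
  have h7 : (2 : ℝ) ^ (-8 - (ℓ : ℤ)) = 2 / 2 ^ (ℓ + 9) := by
    rw [show (-8 - (ℓ : ℤ)) = 1 - ((ℓ + 9 : ℕ) : ℤ) by push_cast; ring, zpow_sub₀ two_ne_zero,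
      zpow_one, zpow_natCast]
  rw [zpow_neg, zpow_natCast, h7, div_div, ← div_eq_mul_inv]
  exact div_le_div_of_nonneg_left zero_le_two (by positivity) h6

/-- The K in the denominator pays for k(r+2)^(ℓ+2). The number of types is paid for by 2^(-ℓ), since
ℓ ≥ 3r + 1 and 1 + 1/(r+2) ≤ 4/3 < 2. -/
theorem proportion_bound {r ℓ k K : ℕ} (hr : 1 ≤ r) (hℓ : 3 * r + 1 ≤ ℓ) (hk : 1 ≤ k)
    (hK : k * (r + 2) ^ (ℓ + 2) ≤ K) :
    2560 * (r + 1) * k * ((2 : ℝ) ^ (-8 - (ℓ : ℤ)) / (((r + 1 : ℕ) : ℝ) ^ 3 * (K : ℝ))) *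
      (r + 2) ^ (ℓ + 1) * (1 + 1 / ((r : ℝ) + 2)) ^ (3 * r + 2) ≤ 1 / (4 * r) := by
  have hr1 : (1 : ℝ) ≤ r := by exact_mod_cast hr
  have hk1 : (1 : ℝ) ≤ k := by exact_mod_cast hk
  have hK' : (k : ℝ) * (r + 2) ^ (ℓ + 2) ≤ K := by exact_mod_cast hK
  have hK0 : (0 : ℝ) < K := lt_of_lt_of_le (by positivity) hK'
  have h1 : (2 : ℝ) ^ (-8 - (ℓ : ℤ)) ≤ 1 / 512 * (1 / 8) ^ r := by
    calc (2 : ℝ) ^ (-8 - (ℓ : ℤ)) ≤ 2 ^ (-((3 * r + 9 : ℕ) : ℤ)) :=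
          zpow_le_zpow_right₀ one_le_two (by omega)
      _ = 1 / 512 * (1 / 8) ^ r := by
          rw [zpow_neg, zpow_natCast, pow_add, pow_mul, one_div_pow]
          norm_num
  have h2 : (1 + 1 / ((r : ℝ) + 2)) ^ (3 * r + 2) ≤ 16 / 9 * (64 / 27) ^ r := by
    calc (1 + 1 / ((r : ℝ) + 2)) ^ (3 * r + 2) ≤ (4 / 3) ^ (3 * r + 2) := by
          refine pow_le_pow_left₀ (by positivity) ?_ _
          have : 1 / ((r : ℝ) + 2) ≤ 1 / 3 :=
            one_div_le_one_div_of_le (by norm_num) (by linarith)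
          linarith
      _ = 16 / 9 * (64 / 27) ^ r := by
          rw [pow_add, pow_mul]
          norm_num
          ring
  have h3 : (2 : ℝ) ^ (-8 - (ℓ : ℤ)) * (1 + 1 / ((r : ℝ) + 2)) ^ (3 * r + 2) ≤ 1 / 972 := by
    calc (2 : ℝ) ^ (-8 - (ℓ : ℤ)) * (1 + 1 / ((r : ℝ) + 2)) ^ (3 * r + 2)
        ≤ (1 / 512 * (1 / 8) ^ r) * (16 / 9 * (64 / 27) ^ r) := by gcongr
      _ = 1 / 288 * (8 / 27) ^ r := by
          rw [show (8 / 27 : ℝ) = 1 / 8 * (64 / 27) by norm_num, mul_pow]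
          ring
      _ ≤ 1 / 288 * (8 / 27) ^ 1 := by
          refine mul_le_mul_of_nonneg_left ?_ (by norm_num)
          exact pow_le_pow_of_le_one (by norm_num) (by norm_num) hr
      _ ≤ 1 / 972 := by norm_num
  have h4 : (k : ℝ) * (r + 2) ^ (ℓ + 1) * (r + 2) ≤ K := by
    rw [mul_assoc, ← pow_succ]
    exact hK'
  push_cast
  calc 2560 * ((r : ℝ) + 1) * k * ((2 : ℝ) ^ (-8 - (ℓ : ℤ)) / (((r : ℝ) + 1) ^ 3 * (K : ℝ))) *
        ((r : ℝ) + 2) ^ (ℓ + 1) * (1 + 1 / ((r : ℝ) + 2)) ^ (3 * r + 2)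
      = 2560 * (k * ((r : ℝ) + 2) ^ (ℓ + 1) / K) / ((r : ℝ) + 1) ^ 2 *
        ((2 : ℝ) ^ (-8 - (ℓ : ℤ)) * (1 + 1 / ((r : ℝ) + 2)) ^ (3 * r + 2)) := by
        generalize (1 + 1 / ((r : ℝ) + 2)) ^ (3 * r + 2) = u
        generalize (2 : ℝ) ^ (-8 - (ℓ : ℤ)) = v
        field_simp
    _ ≤ 2560 * (1 / ((r : ℝ) + 2)) / (r + 1) ^ 2 * (1 / 972) := by
        have h5 : (k : ℝ) * ((r : ℝ) + 2) ^ (ℓ + 1) / K ≤ 1 / ((r : ℝ) + 2) := by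
          rw [div_le_div_iff₀ hK0 (by positivity)]
          linarith
        have h6 := mul_le_mul_of_nonneg_left h5 (show (0 : ℝ) ≤ 2560 by norm_num)
        exact mul_le_mul (div_le_div_of_nonneg_right h6 (by positivity)) h3 (by positivity)
          (by positivity)
    _ ≤ 1 / (4 * (r : ℝ)) := by
        rw [show 2560 * (1 / ((r : ℝ) + 2)) / (r + 1) ^ 2 * (1 / 972) =
          2560 / (972 * ((r + 2) * (r + 1) ^ 2)) by field_simp]
        rw [div_le_div_iff₀ (by positivity) (by positivity)]
        nlinarith [mul_nonneg (show (0 : ℝ) ≤ r - 1 by linarith) (show (0 : ℝ) ≤ r by linarith),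
          mul_nonneg (show (0 : ℝ) ≤ r - 1 by linarith) (sq_nonneg ((r : ℝ) + 1))]

theorem exists_biLevelling_of_expands [Fintype V] {r ℓ k K : ℕ} (hr : 1 ≤ r)
    (hℓ : 3 * r + 1 ≤ ℓ) (hk : 1 ≤ k) (hK : k * (r + 2) ^ (ℓ + 2) ≤ K)
    (hε : ε = (2 : ℝ) ^ (-8 - (ℓ : ℤ)) / (((r + 1 : ℕ) : ℝ) ^ 3 * (K : ℝ)))
    (hE : Expands G A ε δ) (hA : A.length = K) (hδ : 0 < δ) {m : ℕ} (hm : 1 ≤ m)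
    (hδm : δ * m ≤ ε) (hml : Fintype.card V ≤ m ^ r) :
    ∃ S : BiLevelling G, S.Rainbow A ∧ S.length = k ∧ S.height = ℓ ∧
      A.SizeAtLeast S.C (4096 * ε) := by
  have hr1 : (1 : ℝ) ≤ r := by exact_mod_cast hr
  have hk1 : (1 : ℝ) ≤ k := by exact_mod_cast hk
  have hK1 : 1 ≤ K := le_trans (Nat.mul_pos hk (by positivity)) hK
  have hK1' : (1 : ℝ) ≤ K := by exact_mod_cast hK1
  have hε0 : 0 < ε := by
    rw [hε]
    positivity
  have hεr : 4 * ε * (1 + r * (r + 3)) ≤ 1 := by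
    have h1 : (2 : ℝ) ^ (-8 - (ℓ : ℤ)) ≤ 1 / 4 := by
      calc (2 : ℝ) ^ (-8 - (ℓ : ℤ)) ≤ 2 ^ (-2 : ℤ) := zpow_le_zpow_right₀ one_le_two (by omega)
        _ = 1 / 4 := by norm_num
    have h2 : ε * (((r + 1 : ℕ) : ℝ) ^ 3 * K) = (2 : ℝ) ^ (-8 - (ℓ : ℤ)) := by
      rw [hε]
      exact div_mul_cancel₀ _ (by positivity)
    have h3 : (1 + (r : ℝ) * (r + 3)) ≤ ((r + 1 : ℕ) : ℝ) ^ 3 * K := by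
      push_cast
      have h4 : (1 + (r : ℝ) * (r + 3)) ≤ (r + 1) ^ 3 := by
        have : (0 : ℝ) ≤ (r : ℝ) ^ 3 := by positivity
        nlinarith
      exact h4.trans (le_mul_of_one_le_right (by positivity) hK1')
    have h4 := mul_le_mul_of_nonneg_left h3 hε0.le
    linarith
  have hcard : r * (2 * (r + 1) + k * (r + 2) ^ (ℓ + 1)) + (2 * r + 1) ≤ A.index.card + r := by
    have h1 : A.index.card = K := hA
    have h2 : (r + 2) ^ 2 ≤ k * (r + 2) ^ (ℓ + 1) :=
      (Nat.pow_le_pow_right (by omega) (by omega)).trans (Nat.le_mul_of_pos_left _ hk)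
    rw [pow_succ (r + 2) (ℓ + 1), ← mul_assoc] at hK
    rw [h1]
    nlinarith
  have hρ : (0 : ℝ) < r + 1 := by positivity
  -- This φ must be at least 4(r+1)ε for lengthening and at least k(4096ε + ε) for grading, which
  -- holds as r + 1 ≥ 2, yet small enough for `proportion_bound`.
  have hφ0 : 0 < 2560 * (r + 1) * k * ε := by positivity
  obtain ⟨h, m₁, N, a, J, C, hT, hhm, hJ, hC⟩ := hE.exists_twoSided hε0 hδ hm hδm hr hml hεr hℓ hk
    hφ0 (by rw [hε]; exact proportion_bound hr hℓ hk hK) hcard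
  obtain ⟨N', a', J', C', hT', hJ', hC'⟩ := hT.exists_add hE hδ hm hδm hml
    (φ := 2560 * (r + 1) * k * ε)
    (by
      have : (r + 1) * ε ≤ (r + 1) * ε * k := le_mul_of_one_le_right (by positivity) hk1
      have : 0 ≤ (r + 1) * ε := by positivity
      linarith) hk _ hJ hC
  obtain ⟨S, hS1, hS2, hS3, hS4⟩ := hT'.exists_biLevelling hE hε0.le (f := 4096 * ε)
    (by positivity) hk hJ' (fun j hj => by
      refine le_trans (mul_le_mul_of_nonneg_right ?_ (Nat.cast_nonneg _)) (hC' j hj)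
      have : 0 ≤ k * ε * ((r : ℝ) - 1) := mul_nonneg (by positivity) (by linarith)
      have : 0 ≤ k * ε := by positivity
      linarith)
  exact ⟨S, hS1, hS2, by omega, hS4⟩

end

theorem theorem6p3 {V : Type*} [Fintype V] (G : SimpleGraph V)
    (k : ℕ) (hk : 1 ≤ k) (c : ℝ) (hc : 0 < c)
    (ρ : ℕ) (hρ : ρ = ⌈1 + 1 / c⌉₊)
    (ℓ : ℕ) (hℓ : 3 * (ρ : ℤ) - 2 ≤ (ℓ : ℤ))
    (K : ℕ) (hK : K = ⌈(k : ℝ) * (3 + 1 / c) ^ (ℓ + 2)⌉₊)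
    (γ lam : ℝ) (hγ : 0 < γ) (hlam : 0 < lam)
    (hγ' : γ ≤ (2 : ℝ) ^ (-8 - (ℓ : ℤ)) / ((ρ : ℝ) ^ 3 * (K : ℝ)))
    (hlam' : lam ≤ (2 : ℝ) ^ (-8 - (ℓ : ℤ)) / ((ρ : ℝ) ^ 3 * (K : ℝ)))
    (δ : ℝ) (hδ : δ = (K : ℝ) ^ (-(K : ℤ)) * (Fintype.card V : ℝ) ^ (-c))
    (A : Blockade V) (hlen : A.length = K) (hlink : (A.linkage G : ℝ) ≤ lam)
    (hdiv : ¬ A.Divergent G γ δ) :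
    ∃ S : BiLevelling G, S.Rainbow A ∧ S.length = k ∧ S.height = ℓ ∧
      A.SizeAtLeast S.C ((2 : ℝ) ^ (4 - (ℓ : ℤ)) / ((ρ : ℝ) ^ 3 * (K : ℝ))) := by
  have hc' : 0 < 1 / c := by positivity
  have hk1 : (1 : ℝ) ≤ k := by exact_mod_cast hk
  obtain ⟨r, rfl⟩ : ∃ r, ρ = r + 1 := by
    have : 0 < ρ := by
      rw [hρ]
      exact Nat.ceil_pos.2 (by linarith)
    exact ⟨ρ - 1, by omega⟩
  have hr_lt : (r : ℝ) < 1 + 1 / c := by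
    have h1 := Nat.ceil_lt_add_one (show (0 : ℝ) ≤ 1 + 1 / c by linarith)
    rw [← hρ] at h1
    push_cast at h1
    linarith
  have hle_r : 1 / c ≤ r := by
    have h1 := Nat.le_ceil (1 + 1 / c)
    rw [← hρ] at h1
    push_cast at h1
    linarith
  have hcr : 1 ≤ c * r := by
    rwa [div_le_iff₀ hc, mul_comm] at hle_r
  have hr : 1 ≤ r := by
    have : (0 : ℝ) < r := hc'.trans_le hle_r
    exact_mod_cast this
  have hKk : k * (r + 2) ^ (ℓ + 2) ≤ K := by
    have h1 : (k : ℝ) * (r + 2) ^ (ℓ + 2) ≤ k * (3 + 1 / c) ^ (ℓ + 2) :=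
      mul_le_mul_of_nonneg_left (pow_le_pow_left₀ (by positivity) (by linarith) _) (by positivity)
    have h2 := h1.trans (Nat.le_ceil _)
    rw [← hK] at h2
    exact_mod_cast h2
  have hKx : (r + 2) ^ (ℓ + 2) ≤ K := (Nat.le_mul_of_pos_left _ hk).trans hKk
  have hK1 : 1 ≤ K := le_trans (Nat.one_le_pow _ _ (by omega)) hKx
  have hn : 1 ≤ Fintype.card V := by
    obtain ⟨i, hi⟩ : A.index.Nonempty := by
      rw [← Finset.card_pos]
      exact hK1.trans_eq hlen.symm
    obtain ⟨v, -⟩ := A.nonempty i hi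
    exact Fintype.card_pos_iff.2 ⟨v⟩
  obtain ⟨m, hm, hml, hmn⟩ := exists_nat_root hn hc hcr
  have hKpow : (0 : ℝ) < (K : ℝ) ^ (-(K : ℤ)) := zpow_pos (by exact_mod_cast hK1) _
  have hδ0 : 0 < δ := by
    rw [hδ]
    exact mul_pos hKpow (Real.rpow_pos_of_pos (by exact_mod_cast hn) _)
  have hℓr : 3 * r + 1 ≤ ℓ := by
    push_cast at hℓ
    omega
  have hδm : δ * m ≤ (2 : ℝ) ^ (-8 - (ℓ : ℤ)) / (((r + 1 : ℕ) : ℝ) ^ 3 * (K : ℝ)) := by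
    refine le_trans ?_ (two_mul_inv_pow_le hr hℓr hKx)
    rw [hδ, mul_assoc, mul_comm 2]
    refine mul_le_mul_of_nonneg_left ?_ hKpow.le
    rwa [mul_comm]
  obtain ⟨S, hS1, hS2, hS3, hS4⟩ := exists_biLevelling_of_expands hr hℓr hk hKk rfl
    (A.expands (hlink.trans hlam') hγ' hdiv) hlen hδ0 hm hδm hml
  refine ⟨S, hS1, hS2, hS3, ?_⟩
  -- The required size is 4096ε, with 4096 = 2^12.
  have h1 : (2 : ℝ) ^ (4 - (ℓ : ℤ)) = 4096 * 2 ^ (-8 - (ℓ : ℤ)) := by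
    rw [show (4 - (ℓ : ℤ)) = 12 + (-8 - (ℓ : ℤ)) by ring, zpow_add₀ two_ne_zero]
    norm_num
  rw [h1, mul_div_assoc]
  exact hS4
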